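/- **Theorem (Top-$m$ arm identification for modal bandits).** *Setting.* Let $D\ge 1$ and $1\le m<K$. Arm $i\in\{1,\dots,K\}$ has a reward density $f_i$ on $\mathbb R^D$ such that $f_i$ vanishes outside a compact set on which it is continuous, and $f_i$ has a top mode $x_i$: $f_i(x)<f_i(x_i)$ for all $x\ne x_i$, $f_i$ is twice differentiable in a neighbourhood of $x_i$, and its Hessian at $x_i$ is negative definite. Let $r:\mathbb R^D\to\mathbb R$ be an $L$-Lipschitz score function, and let $\theta_i=r(x_i)$. The arms are indexed so that $\theta_1\ge\dots\ge\theta_K$, and $\theta_m>\theta_{m+1}$. Put $$\widetilde\Delta_i=\begin{cases}\theta_i-\theta_{m+1}&\text{if }\theta_i\ge\theta_m,\\ \theta_m-\theta_i&\text{if }\theta_i\le\theta_{m+1},\end{cases}\qquad \Sigma=\sum_{i=1}^K\widetilde\Delta_i^{-(4+D)} .$$ All pulls of an arm return independent samples from its density, and different arms are independent. *Mode estimate.* For a sample $S$ of $s$ points, $\widehat{\mathrm{mode}}(S)$ is a point $x\in S$ that minimizes $r_k(x)=\inf\{\rho\ge 0:|B(x,\rho)\cap S|\ge k\}$, where $k=s^{4/(4+D)}$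 and $B(x,\rho)$ is the closed Euclidean ball. *Algorithm.* Its parameters are $\delta\in(0,1)$, $m$ and $N_0$. For $t\ge 1$ and $\delta'>0$ let $$U(t,\delta')=\bigl(\log(ct^2)+\log(1/\delta')\bigr)\frac{\log t}{t^{1/(4+D)}},\qquad c=\sum_{i\ge N_0}\frac1{i^2}.$$ First pull each arm $N_0$ times. Then proceed in rounds. In a round, let $T_i$ be the number of pulls of arm $i$ so far, and let $\hat\theta_i$ be the score of the mode estimate of the $T_i$ rewards of arm $i$. Let $H$ be a set of $m$ arms with the highest $\hat\theta_i$. Let $h$ minimize $b_i=\hat\theta_i-U\bigl(T_i,\tfrac{\delta}{2(K-m)}\bigr)$ over $i\in H$, and let $l$ maximize $b'_i=\hat\theta_i+U\bigl(T_i,\tfrac{\delta}{2m}\bigr)$ over $i\notin H$. If $b_h\ge b'_l$, stop and return $H$. Otherwise, independently of everything else, pull $h$ with probability $T_l/(T_h+T_l)$, and pull $l$ otherwise. All ties are broken by arbitrary fixed deterministic rules. *Claim.* There is a universal constant $C_0>0$; for every $D\ge1$ there is a real polynomial $p_D$ in two variables; and for all $D\ge1$ and $L\ge0$ there is an assignment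 $f\mapsto N_f\in\mathbb N$ that associates a number to each density $f$, such that the following holds. For all $m$, $K$, $\delta$, arms $f_1,\dots,f_K$ and scores $r$ as above, for every $N_0\ge\max_iN_{f_i}$ (in particular for $N_0=\max_iN_{f_i}$), and for every $n\in\mathbb N$ with $$n\ \ge\ C_0KN_0+p_D\bigl(\log\tfrac1\delta,\ \log\Sigma\bigr)\cdot\Sigma ,$$ with probability at least $1-\delta$ the algorithm stops after at most $n$ pulls in total and returns exactly the set $\{1,\dots,m\}$ of the top $m$ arms. -/

import Mathlib

open MeasureTheory ProbabilityTheory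

noncomputable section

namespace ModalBandit

/-- The reward space `ℝ^D` with its Euclidean norm. -/
abbrev Pt (D : ℕ) : Type := EuclideanSpace ℝ (Fin D)

/-- `f` is a probability density on `ℝ^D` that vanishes outside a compact set on which it is
continuous, and `x₀` is its top mode: the unique point of highest density, around which `f` is
twice differentiable, with a negative definite Hessian at `x₀`. -/
structure IsTopMode {D : ℕ} (f : Pt D → ℝ) (x₀ : Pt D) : Prop where
  nonneg : ∀ x, 0 ≤ f x
  mass : ∫⁻ x, ENNReal.ofReal (f x) = 1
  support : ∃ S : Set (Pt D), IsCompact S ∧ ContinuousOn f S ∧ ∀ x, x ∉ S → f x = 0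
  top : ∀ x, x ≠ x₀ → f x < f x₀
  diff : ∀ᶠ x in nhds x₀, DifferentiableAt ℝ f x ∧ DifferentiableAt ℝ (fderiv ℝ f) x
  hess : ∀ v : Pt D, v ≠ 0 → fderiv ℝ (fderiv ℝ f) x₀ v v < 0

/-- A tie-breaking rule: it picks one element of every nonempty finite set. -/
structure TieBreak (α : Type) where
  pick : Finset α → α
  pick_mem : ∀ S : Finset α, S.Nonempty → pick S ∈ S

/-- The `k`-nearest-neighbour radius of `y` with respect to the sample `x 0, …, x (n - 1)`. -/
def knnRadius {D : ℕ} (k : ℝ) (n : ℕ) (x : ℕ → Pt D) (y : Pt D) : ℝ :=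
  sInf {ρ : ℝ | 0 ≤ ρ ∧ k ≤ (((Finset.range n).filter (fun j => dist (x j) y ≤ ρ)).card : ℝ)}

open Classical in
/-- The (indices of the) sample points among `x 0, …, x (n - 1)` of smallest `k`-nearest-neighbour
radius, where `k = n^{4/(4+D)}`. -/
def modeCandidates {D : ℕ} (n : ℕ) (x : ℕ → Pt D) : Finset ℕ :=
  (Finset.range n).filter (fun j => ∀ j' ∈ Finset.range n,
    knnRadius ((n : ℝ) ^ ((4 : ℝ) / (4 + D))) n x (x j) ≤
      knnRadius ((n : ℝ) ^ ((4 : ℝ) / (4 + D))) n x (x j'))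

/-- The estimated mode of the sample `x 0, …, x (n - 1)`. -/
def empMode {D : ℕ} (σ : TieBreak ℕ) (n : ℕ) (x : ℕ → Pt D) : Pt D :=
  x (σ.pick (modeCandidates n x))

/-- The confidence radius `U(t, δ)`, with `c = ∑_{i ≥ N₀} 1 / i²`. -/
def confRadius (D N₀ t : ℕ) (δ : ℝ) : ℝ :=
  (Real.log ((∑' i : ℕ, 1 / ((N₀ + i : ℕ) : ℝ) ^ 2) * (t : ℝ) ^ 2) + Real.log (1 / δ)) *
    (Real.log t / (t : ℝ) ^ ((1 : ℝ) / (4 + D)))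

/-- The inputs of the top-`m` algorithm: the number `m` of arms to return, the number `N₀` of
initial pulls of each arm, the confidence parameter, the score function and the tie-breaking
rules. -/
structure TopM (D K : ℕ) where
  m : ℕ
  N₀ : ℕ
  δ : ℝ
  score : Pt D → ℝ
  tieSample : TieBreak ℕ
  tieSet : TieBreak (Finset (Fin K))
  tieArm : TieBreak (Fin K)

namespace TopM

/- In what follows `x i s` is the reward that the pull number `s` (from `0`) of arm `i` returns,
`T i` is the number of pulls of arm `i` made so far, and `u j` is the coin, uniform on `[0, 1]`,
that is tossed in round `j`. -/

variable {D K : ℕ} (A : TopM D K)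

/-- The score of the empirical mode of arm `i`. -/
def value (x : Fin K → ℕ → Pt D) (T : Fin K → ℕ) (i : Fin K) : ℝ :=
  A.score (empMode A.tieSample (T i) (x i))

open Classical in
/-- `H`: the `m` arms of highest empirical value. -/
def high (x : Fin K → ℕ → Pt D) (T : Fin K → ℕ) : Finset (Fin K) :=
  A.tieSet.pick ((Finset.powersetCard A.m Finset.univ).filter
    (fun S => ∀ i ∈ S, ∀ j ∉ S, A.value x T j ≤ A.value x T i))

/-- The lower confidence bound, which is used for the arms in `H`. -/
def lcb (x : Fin K → ℕ → Pt D) (T : Fin K → ℕ) (i : Fin K) : ℝ :=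
  A.value x T i - confRadius D A.N₀ (T i) (A.δ / (2 * ((K : ℝ) - A.m)))

/-- The upper confidence bound, which is used for the arms outside `H`. -/
def ucb (x : Fin K → ℕ → Pt D) (T : Fin K → ℕ) (i : Fin K) : ℝ :=
  A.value x T i + confRadius D A.N₀ (T i) (A.δ / (2 * (A.m : ℝ)))

open Classical in
/-- `h`: an arm of `H` with the lowest lower confidence bound. -/
def hArm (x : Fin K → ℕ → Pt D) (T : Fin K → ℕ) : Fin K :=
  A.tieArm.pick ((A.high x T).filter (fun i => ∀ j ∈ A.high x T, A.lcb x T i ≤ A.lcb x T j))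

open Classical in
/-- `l`: an arm outside `H` with the highest upper confidence bound. -/
def lArm (x : Fin K → ℕ → Pt D) (T : Fin K → ℕ) : Fin K :=
  A.tieArm.pick ((A.high x T)ᶜ.filter
    (fun i => ∀ j ∈ (A.high x T)ᶜ, A.ucb x T j ≤ A.ucb x T i))

/-- The stopping rule. -/
def Stops (x : Fin K → ℕ → Pt D) (T : Fin K → ℕ) : Prop :=
  A.ucb x T (A.lArm x T) ≤ A.lcb x T (A.hArm x T)

open Classical in
/-- The arm that is pulled if the algorithm does not stop: `h` with probability
`T_l / (T_h + T_l)`, otherwise `l`. -/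
def nextArm (x : Fin K → ℕ → Pt D) (T : Fin K → ℕ) (v : ℝ) : Fin K :=
  if v < (T (A.lArm x T) : ℝ) / ((T (A.hArm x T) : ℝ) + (T (A.lArm x T) : ℝ)) then A.hArm x T
  else A.lArm x T

open Classical in
/-- One round of the algorithm. Nothing changes any more once the stopping rule holds. -/
def step (x : Fin K → ℕ → Pt D) (T : Fin K → ℕ) (v : ℝ) : Fin K → ℕ :=
  if A.Stops x T then T
  else Function.update T (A.nextArm x T v) (T (A.nextArm x T v) + 1)

/-- The numbers of pulls of the arms after the initial phase and `j` rounds. -/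
def counts (A : TopM D K) (x : Fin K → ℕ → Pt D) (u : ℕ → ℝ) : ℕ → Fin K → ℕ
  | 0 => fun _ => A.N₀
  | j + 1 => A.step x (counts A x u j) (u j)

/-- The algorithm stops by its stopping rule after at most `n` pulls in total, and returns `S`. -/
def StopsWithin (x : Fin K → ℕ → Pt D) (u : ℕ → ℝ) (n : ℕ) (S : Finset (Fin K)) : Prop :=
  ∃ j : ℕ, K * A.N₀ + j ≤ n ∧ A.Stops x (A.counts x u j) ∧ A.high x (A.counts x u j) = S

end TopM

/-- The random inputs: `X i s` are independent rewards, `X i s` with density `f i`, and `U j` are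
independent coins, uniform on `[0, 1]` and independent of the rewards. -/
structure IsEnvironment {D K : ℕ} {Ω : Type*} [MeasurableSpace Ω] (P : Measure Ω)
    (f : Fin K → Pt D → ℝ) (X : Fin K → ℕ → Ω → Pt D) (U : ℕ → Ω → ℝ) : Prop where
  measurable_reward : ∀ i s, Measurable (X i s)
  measurable_coin : ∀ j, Measurable (U j)
  law_reward : ∀ i s, P.map (X i s) = volume.withDensity (fun y => ENNReal.ofReal (f i y))
  law_coin : ∀ j, P.map (U j) = volume.restrict (Set.Icc (0 : ℝ) 1)
  indep_reward : iIndepFun (fun p : Fin K × ℕ => X p.1 p.2) P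
  indep_coin : iIndepFun U P
  indep_reward_coin :
    IndepFun (fun ω (p : Fin K × ℕ) => X p.1 p.2 ω) (fun ω (j : ℕ) => U j ω) P

/-- The gap of arm `i`: the arms are indexed from `0`, so that the values numbered `m` and `m + 1`
are `θ (m - 1)` and `θ m`. -/
def gap {K : ℕ} (θ : Fin K → ℝ) (m : ℕ) (hm : 0 < m) (hmK : m < K) (i : Fin K) : ℝ :=
  if θ ⟨m - 1, by omega⟩ ≤ θ i then θ i - θ ⟨m, hmK⟩ else θ ⟨m - 1, by omega⟩ - θ i

/-- The hardness `∑ᵢ gapᵢ^{-(4+D)}`. -/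
def hardness (D : ℕ) {K : ℕ} (θ : Fin K → ℝ) (m : ℕ) (hm : 0 < m) (hmK : m < K) : ℝ :=
  ∑ i, (gap θ m hm hmK i ^ (4 + D))⁻¹

end ModalBandit

end

open ModalBandit

/-!
The proof has a statistical and an algorithmic half.

*Mode estimate.* Write `t` for the sample size, `τ = t^{1/(4+D)}`, `k = τ⁴` and
`λ = log t + log (1/d)`. Near its top mode a density lies between two parabolas, and compactness of
the support extends the upper one to all of it (`IsTopMode.exists_parabolas`). Take `ρ`, of order
`1/τ`, such that a ball of radius `ρ` and constant density `f x₀` has mass `(1 + β) k / t`, where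
`β = λ log t / √k`. The lower parabola loses only a relative `O(ρ²)`, which is small against `β`, on
balls around points within `ρ` of the mode; the upper one loses more than `2β` at distance
`ε`, of order `λ log t / τ`. So balls of radius `ρ` of the first kind have an expected number of
sample points above `k (1 + β/2)`, those of the second kind have one below `k (1 - β)`. Chernoff's
bound, used conditionally on the centre, which is itself a sample point (`measure_prodMk_mem_le`),
and a union bound over the sample show that the estimated mode is within `ε` of the mode except
with probability `9 t exp (-k β²/32)` (`measure_lt_dist_empMode_le`). The exponent is
`(λ log t)²/32`, which beats any multiple of `λ` for large `t`; this leaves a failure probability of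
at most `d / t²`, where `ε`, times the Lipschitz constant, is at most the confidence radius
(`exists_forall_measure_confRadius_lt_le`). No uniform deviation theory is needed, as the
confidence radius is wider than the true fluctuations by logarithmic factors.

*Algorithm.* On the event `TopM.Good` that all estimated scores are within their confidence radii,
the algorithm can only stop with the top set (`TopM.Good.high_eq`). While it runs, both critical
arms have gaps at most four times the larger of their two confidence radii (`gap_le_of_overlap`).
Radii decrease with the number of pulls, so the less often pulled critical arm, the rare arm, has
been pulled at most `gap^{-(4+D)}` times a logarithmic factor (`le_logFactor_of_gap_le`). The rare
arm is pulled in each round with probability at least `1/2`. More precisely, each half of `[0, 1]`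
is the favourable one for one of the two critical arms, and the coin falls into the half that is
favourable for the rare arm independently of the past with probability exactly `1/2`. Hence there
are at most `B = logFactor * Σ` favourable rounds before the algorithm stops
(`TopM.card_favourable_le`), whereas among `J` rounds there are that few with probability at most
`exp (B - J/4)` (`measure_card_guess_le`). If `B < 1` the algorithm stops at once on the event
`TopM.Good`; otherwise `J ≥ 8 (2 + log (1/δ)) B` rounds make this probability at most `δ/2`.

The logarithmic factor contains `log K`, which is not controlled by `log (1/δ)` and `log Σ`. Where
it is not, `Σ ≤ √K`, and the whole budget is at most the cost `K N₀` of the initial pulls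
(`exists_budget_le`).
-/

open Filter Topology

namespace ModalBandit

/-! ### The shape of a density around its top mode -/

/-- Second-order Taylor expansion at a critical point, from differentiability of the derivative at
that point only. -/
theorem eventually_abs_sub_taylor_le {E : Type*} [NormedAddCommGroup E] [NormedSpace ℝ E]
    {f : E → ℝ} {x₀ : E} (hf : ∀ᶠ x in 𝓝 x₀, DifferentiableAt ℝ f x)
    (hf' : DifferentiableAt ℝ (fderiv ℝ f) x₀) (h0 : fderiv ℝ f x₀ = 0) {η : ℝ} (hη : 0 < η) :
    ∃ r > 0, ∀ v : E, ‖v‖ < r →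
      |f (x₀ + v) - f x₀ - fderiv ℝ (fderiv ℝ f) x₀ v v / 2| ≤ η * ‖v‖ ^ 2 := by
  set H := fderiv ℝ (fderiv ℝ f) x₀ with hH
  have h1 : ∀ᶠ x in 𝓝 x₀, ‖fderiv ℝ f x - fderiv ℝ f x₀ - H (x - x₀)‖ ≤ η * ‖x - x₀‖ :=
    hf'.hasFDerivAt.isLittleO.bound hη
  obtain ⟨r, hr, hball⟩ := Metric.eventually_nhds_iff.1 (hf.and h1)
  refine ⟨r, hr, fun v hv => ?_⟩
  have hmem : ∀ t ∈ Set.Icc (0 : ℝ) 1, dist (x₀ + t • v) x₀ < r := by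
    intro t ht
    rw [dist_eq_norm, add_sub_cancel_left, norm_smul, Real.norm_of_nonneg ht.1]
    nlinarith [ht.2, norm_nonneg v]
  have hder : ∀ t ∈ Set.Icc (0 : ℝ) 1,
      HasDerivWithinAt (fun t : ℝ => f (x₀ + t • v) - t ^ 2 * (H v v / 2))
        ((fderiv ℝ f (x₀ + t • v) - H (t • v)) v) (Set.Icc 0 1) t := by
    intro t ht
    have hd := (hball (hmem t ht)).1.hasFDerivAt
    have hl : HasDerivAt (fun t : ℝ => x₀ + t • v) v t := by
      simpa using ((hasDerivAt_id t).smul_const v).const_add x₀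
    have h2 := (hd.comp_hasDerivAt t hl).sub (((hasDerivAt_pow 2 t)).mul_const (H v v / 2))
    refine HasDerivAt.hasDerivWithinAt ?_
    convert! h2 using 1
    simp
    ring
  have hbd : ∀ t ∈ Set.Ico (0 : ℝ) 1,
      ‖(fderiv ℝ f (x₀ + t • v) - H (t • v)) v‖ ≤ η * ‖v‖ ^ 2 := by
    intro t ht
    have h3 := (hball (hmem t (Set.Ico_subset_Icc_self ht))).2
    rw [h0, sub_zero, add_sub_cancel_left, norm_smul, Real.norm_of_nonneg ht.1] at h3
    calc _ ≤ ‖fderiv ℝ f (x₀ + t • v) - H (t • v)‖ * ‖v‖ := ContinuousLinearMap.le_opNorm _ _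
      _ ≤ (η * (1 * ‖v‖)) * ‖v‖ := by
        gcongr
        exact h3.trans (by gcongr; exact ht.2.le)
      _ = η * ‖v‖ ^ 2 := by ring
  have := norm_image_sub_le_of_norm_deriv_le_segment_01' hder hbd
  simp only [one_smul, one_pow, one_mul, zero_smul, add_zero, Real.norm_eq_abs] at this
  convert this using 2
  ring

variable {D : ℕ}

theorem IsTopMode.pos {f : Pt D → ℝ} {x₀ : Pt D} (h : IsTopMode f x₀) (hD : 0 < D) :
    0 < f x₀ := by
  have : Nonempty (Fin D) := ⟨⟨0, hD⟩⟩
  obtain ⟨y, hy⟩ := exists_ne x₀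
  exact (h.nonneg y).trans_lt (h.top y hy)

/-- A density with a top mode lies between two parabolas: below `f x₀ - a |x - x₀|²` on its whole
support, and above `f x₀ - B |x - x₀|²` near the mode. -/
theorem IsTopMode.exists_parabolas {f : Pt D → ℝ} {x₀ : Pt D} (h : IsTopMode f x₀) (hD : 0 < D) :
    ∃ B r a R : ℝ, 0 < B ∧ 0 < r ∧ 0 < a ∧ 0 < R ∧
      (∀ x, dist x x₀ ≤ r → f x₀ - B * dist x x₀ ^ 2 ≤ f x) ∧
      (∀ x, dist x x₀ ≤ R + 1 → f x ≤ f x₀ - a * dist x x₀ ^ 2) ∧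
      (∀ x, R < dist x x₀ → f x = 0) := by
  have : Nonempty (Fin D) := ⟨⟨0, hD⟩⟩
  have hpos := h.pos hD
  have hcrit : fderiv ℝ f x₀ = 0 := by
    refine IsLocalMax.fderiv_eq_zero (Eventually.of_forall fun x => ?_)
    rcases eq_or_ne x x₀ with rfl | hx
    · exact le_rfl
    · exact (h.top x hx).le
  set H := fderiv ℝ (fderiv ℝ f) x₀ with hH
  -- Compactness of the sphere makes the negative definite Hessian uniformly negative.
  obtain ⟨b, hb, hHb⟩ : ∃ b > 0, ∀ v : Pt D, H v v ≤ -b * ‖v‖ ^ 2 := by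
    have hc : Continuous fun v : Pt D => H v v := by fun_prop
    obtain ⟨w, hw, hmax⟩ := (isCompact_sphere (0 : Pt D) 1).exists_isMaxOn
      (NormedSpace.sphere_nonempty.2 zero_le_one) hc.continuousOn
    have hw0 : w ≠ 0 := by
      rintro rfl
      simp at hw
    refine ⟨-H w w, neg_pos.2 (h.hess w hw0), fun v => ?_⟩
    rcases eq_or_ne v 0 with rfl | hv
    · simp
    have hv' : 0 < ‖v‖ := norm_pos_iff.2 hv
    have h1 : H (‖v‖⁻¹ • v) (‖v‖⁻¹ • v) ≤ H w w := hmax (by simp [norm_smul, hv'.ne'])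
    simp only [map_smul, smul_apply, smul_eq_mul] at h1
    have h2 : H v v = ‖v‖ ^ 2 * (‖v‖⁻¹ * (‖v‖⁻¹ * H v v)) := by field_simp
    rw [h2]
    nlinarith [sq_nonneg ‖v‖]
  obtain ⟨r, hr, htay⟩ := eventually_abs_sub_taylor_le (h.diff.mono fun _ hx => hx.1)
    h.diff.self_of_nhds.2 hcrit (η := b / 4) (by positivity)
  obtain ⟨S, hS, hfS, hf0⟩ := h.support
  obtain ⟨R, hR, hSR⟩ : ∃ R > 0, S ⊆ Metric.closedBall x₀ R := by
    obtain ⟨R, hR⟩ := hS.isBounded.subset_closedBall x₀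
    exact ⟨max R 1, by positivity, hR.trans (Metric.closedBall_subset_closedBall (le_max_left _ _))⟩
  obtain ⟨g, hg, hgap⟩ : ∃ g > 0, ∀ x, r ≤ dist x x₀ → f x ≤ f x₀ - g := by
    have hK : IsCompact (S \ Metric.ball x₀ r) := hS.diff Metric.isOpen_ball
    rcases (S \ Metric.ball x₀ r).eq_empty_or_nonempty with he | hne
    · refine ⟨f x₀, hpos, fun x hx => ?_⟩
      rw [hf0 x fun hxS => ?_]
      · simp
      · have : x ∈ S \ Metric.ball x₀ r := ⟨hxS, by simpa using hx⟩
        simp [he] at this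
    · obtain ⟨w, hw, hmax⟩ := hK.exists_isMaxOn hne (hfS.mono Set.sdiff_subset)
      have hw0 : w ≠ x₀ := by
        rintro rfl
        exact hw.2 (Metric.mem_ball_self hr)
      refine ⟨min (f x₀ - f w) (f x₀), lt_min (sub_pos.2 (h.top w hw0)) hpos, fun x hx => ?_⟩
      by_cases hxS : x ∈ S
      · have : f x ≤ f w := hmax ⟨hxS, by simpa using hx⟩
        linarith [min_le_left (f x₀ - f w) (f x₀)]
      · rw [hf0 x hxS]
        linarith [min_le_right (f x₀ - f w) (f x₀)]
  refine ⟨‖H‖ + b, r / 2, min (b / 4) (g / (R + 1) ^ 2), R, by positivity, by positivity,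
    by positivity, hR, fun x hx => ?_, fun x hx => ?_, fun x hx => hf0 x fun hxS => ?_⟩
  · have hx' : ‖x - x₀‖ < r := by rw [← dist_eq_norm]; linarith
    have h1 := htay (x - x₀) hx'
    rw [add_sub_cancel, ← hH] at h1
    have h2 : |H (x - x₀) (x - x₀)| ≤ ‖H‖ * ‖x - x₀‖ * ‖x - x₀‖ := H.le_opNorm₂ _ _
    rw [dist_eq_norm]
    have h3 := abs_le.1 h1
    have h4 := abs_le.1 h2
    nlinarith [sq_nonneg ‖x - x₀‖, norm_nonneg H, mul_nonneg (norm_nonneg H) (sq_nonneg ‖x - x₀‖)]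
  · rcases lt_or_ge (dist x x₀) r with hxr | hxr
    · have h1 := htay (x - x₀) (by rwa [← dist_eq_norm])
      rw [add_sub_cancel, ← hH] at h1
      have h2 := (abs_le.1 h1).2
      have h3 := hHb (x - x₀)
      rw [dist_eq_norm]
      have h4 := mul_le_mul_of_nonneg_right (min_le_left (b / 4) (g / (R + 1) ^ 2))
        (sq_nonneg ‖x - x₀‖)
      linarith
    · have h1 := hgap x hxr
      have h2 : min (b / 4) (g / (R + 1) ^ 2) * dist x x₀ ^ 2 ≤ g / (R + 1) ^ 2 * (R + 1) ^ 2 := by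
        gcongr
        exact min_le_right _ _
      rw [div_mul_cancel₀ _ (by positivity)] at h2
      linarith
  · exact absurd (hSR hxS) (by simpa using hx)

/-- The law of a reward with density `f`. -/
noncomputable def rewardLaw (f : Pt D → ℝ) : Measure (Pt D) :=
  volume.withDensity fun y => ENNReal.ofReal (f y)

/-- The volume of the unit ball. -/
noncomputable def unitBallVol (D : ℕ) : ℝ := (volume (Metric.ball (0 : Pt D) 1)).toReal

theorem unitBallVol_pos (D : ℕ) : 0 < unitBallVol D :=
  ENNReal.toReal_pos (Metric.measure_ball_pos _ _ one_pos).ne' measure_ball_lt_top.ne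

theorem volume_closedBall_eq (y : Pt D) {ρ : ℝ} (hρ : 0 ≤ ρ) :
    volume (Metric.closedBall y ρ) = ENNReal.ofReal (ρ ^ D * unitBallVol D) := by
  rw [Measure.addHaar_closedBall _ _ hρ, ENNReal.ofReal_mul (by positivity), unitBallVol,
    ENNReal.ofReal_toReal measure_ball_lt_top.ne]
  simp

theorem rewardLaw_closedBall_le {f : Pt D → ℝ} {y : Pt D} {ρ M : ℝ} (hρ : 0 ≤ ρ)
    (hf : ∀ x, dist x y ≤ ρ → f x ≤ M) :
    rewardLaw f (Metric.closedBall y ρ) ≤ ENNReal.ofReal (M * (ρ ^ D * unitBallVol D)) := by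
  have hv := unitBallVol_pos D
  rw [rewardLaw, withDensity_apply _ Metric.isClosed_closedBall.measurableSet]
  calc _ ≤ ∫⁻ _ in Metric.closedBall y ρ, ENNReal.ofReal M :=
        setLIntegral_mono' Metric.isClosed_closedBall.measurableSet
          fun x hx => ENNReal.ofReal_le_ofReal (hf x hx)
    _ = ENNReal.ofReal (M * (ρ ^ D * unitBallVol D)) := by
      rw [setLIntegral_const, volume_closedBall_eq _ hρ, ← ENNReal.ofReal_mul' (by positivity)]

theorem le_rewardLaw_closedBall {f : Pt D → ℝ} {y : Pt D} {ρ M : ℝ} (hρ : 0 ≤ ρ)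
    (hf : ∀ x, dist x y ≤ ρ → M ≤ f x) :
    ENNReal.ofReal (M * (ρ ^ D * unitBallVol D)) ≤ rewardLaw f (Metric.closedBall y ρ) := by
  have hv := unitBallVol_pos D
  rw [rewardLaw, withDensity_apply _ Metric.isClosed_closedBall.measurableSet]
  calc _ = ∫⁻ _ in Metric.closedBall y ρ, ENNReal.ofReal M := by
        rw [setLIntegral_const, volume_closedBall_eq _ hρ, ← ENNReal.ofReal_mul' (by positivity)]
    _ ≤ _ := setLIntegral_mono' Metric.isClosed_closedBall.measurableSet
          fun x hx => ENNReal.ofReal_le_ofReal (hf x hx)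

theorem rewardLaw_compl_closedBall {f : Pt D → ℝ} {y : Pt D} {ρ : ℝ}
    (hf : ∀ x, ρ < dist x y → f x = 0) : rewardLaw f (Metric.closedBall y ρ)ᶜ = 0 := by
  rw [rewardLaw, withDensity_apply _ Metric.isClosed_closedBall.measurableSet.compl]
  rw [setLIntegral_congr_fun Metric.isClosed_closedBall.measurableSet.compl
    (g := fun _ => 0) fun x hx => by simp [hf x (by simpa using hx)]]
  simp

/-! ### Chernoff bounds for numbers of hits -/

section Chernoff

variable {Ω α : Type*} [MeasurableSpace Ω] [MeasurableSpace α] {P : Measure Ω}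
  [IsProbabilityMeasure P]

/-- The number of indices in `s` for which the sample point lies in `B`, as a real number. -/
noncomputable def hits (X : ℕ → Ω → α) (B : Set α) (s : Finset ℕ) : Ω → ℝ :=
  ∑ i ∈ s, fun ω => B.indicator 1 (X i ω)

theorem mgf_indicator {Y : Ω → α} (hY : Measurable Y) {B : Set α} (hB : MeasurableSet B) (σ : ℝ) :
    mgf (fun ω => B.indicator 1 (Y ω)) P σ = 1 + P.real (Y ⁻¹' B) * (Real.exp σ - 1) := by
  have h1 : (fun ω => Real.exp (σ * B.indicator 1 (Y ω))) =
      fun ω => 1 + (Y ⁻¹' B).indicator (fun _ => Real.exp σ - 1) ω := by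
    ext ω
    by_cases h : Y ω ∈ B <;> simp [h]
  rw [mgf, h1, integral_add (integrable_const _)
    ((integrable_const _).indicator (hY hB)), integral_indicator_const _ (hY hB)]
  simp

variable {X : ℕ → Ω → α} {B : Set α} {s : Finset ℕ} {p : ℝ}

theorem mgf_hits_le (hX : ∀ i, Measurable (X i)) (hi : iIndepFun X P) (hB : MeasurableSet B)
    (hp : ∀ i ∈ s, P.real (X i ⁻¹' B) = p) (σ : ℝ) :
    mgf (hits X B s) P σ ≤ Real.exp (s.card * p * (Real.exp σ - 1)) := by
  have hind : iIndepFun (fun i ω => B.indicator (1 : α → ℝ) (X i ω)) P :=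
    hi.comp (fun _ => B.indicator 1) fun _ => measurable_one.indicator hB
  rw [hits, hind.mgf_sum fun i => (measurable_one.indicator hB).comp (hX i)]
  rw [Finset.prod_congr rfl fun i his => by rw [mgf_indicator (hX i) hB, hp i his]]
  rw [Finset.prod_const, mul_assoc, Real.exp_nat_mul]
  rcases s.eq_empty_or_nonempty with rfl | ⟨i, his⟩
  · simp
  gcongr
  · rw [← hp i his, ← mgf_indicator (hX i) hB]
    exact mgf_nonneg
  · linarith [Real.add_one_le_exp (p * (Real.exp σ - 1))]

theorem integrable_exp_hits (hX : ∀ i, Measurable (X i)) (hB : MeasurableSet B) (σ : ℝ) :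
    Integrable (fun ω => Real.exp (σ * hits X B s ω)) P := by
  have hm : Measurable (hits X B s) := by
    have : hits X B s = fun ω => ∑ i ∈ s, B.indicator 1 (X i ω) := by
      ext ω
      simp [hits]
    rw [this]
    exact Finset.measurable_sum _ fun i _ => (measurable_one.indicator hB).comp (hX i)
  have h0 : ∀ ω, 0 ≤ hits X B s ω ∧ hits X B s ω ≤ s.card := by
    intro ω
    simp only [hits, Finset.sum_apply]
    refine ⟨Finset.sum_nonneg fun i _ => Set.indicator_nonneg (fun _ _ => zero_le_one) _, ?_⟩
    calc _ ≤ ∑ _i ∈ s, (1 : ℝ) := Finset.sum_le_sum fun i _ =>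
          Set.indicator_le_self' (f := 1) (fun _ _ => zero_le_one) _
      _ = s.card := by simp
  refine Integrable.of_bound ((hm.const_mul σ).exp.aestronglyMeasurable)
    (Real.exp (|σ| * s.card)) (ae_of_all _ fun ω => ?_)
  rw [Real.norm_of_nonneg (Real.exp_pos _).le, Real.exp_le_exp]
  calc _ ≤ |σ| * hits X B s ω := mul_le_mul_of_nonneg_right (le_abs_self σ) (h0 ω).1
    _ ≤ _ := mul_le_mul_of_nonneg_left (h0 ω).2 (abs_nonneg σ)

variable {k β : ℝ}

/-- Chernoff's bound for the event that a ball of mass below average is crowded. -/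
theorem measure_le_hits (hX : ∀ i, Measurable (X i)) (hi : iIndepFun X P) (hB : MeasurableSet B)
    (hp : ∀ i ∈ s, P.real (X i ⁻¹' B) = p) (hk : 0 ≤ k) (hβ : 0 ≤ β) (hβ1 : β ≤ 1)
    (hsp : s.card * p ≤ k * (1 - β)) :
    P.real {ω | k - 1 ≤ hits X B s ω} ≤ Real.exp (1 - k * β ^ 2 / 32) := by
  refine (measure_ge_le_exp_mul_mgf (t := β / 2) _ (by positivity)
    (integrable_exp_hits hX hB _)).trans ?_
  refine (mul_le_mul_of_nonneg_left (mgf_hits_le hX hi hB hp _) (Real.exp_pos _).le).trans ?_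
  rw [← Real.exp_add, Real.exp_le_exp]
  have h1 := (abs_le.1 (Real.abs_exp_sub_one_sub_id_le (x := β / 2)
    (by rw [abs_of_nonneg (by positivity)]; linarith))).2
  have h2 : 0 ≤ Real.exp (β / 2) - 1 := by linarith [Real.add_one_le_exp (β / 2)]
  have h3 := mul_le_mul_of_nonneg_right hsp h2
  have h4 : k * (1 - β) * (Real.exp (β / 2) - 1) ≤ k * (1 - β) * (β / 2 + (β / 2) ^ 2) :=
    mul_le_mul_of_nonneg_left (by linarith) (mul_nonneg hk (by linarith))
  nlinarith [mul_nonneg hk (sq_nonneg β), mul_nonneg (mul_nonneg hk (sq_nonneg β)) hβ]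

/-- Chernoff's bound for the event that a ball of mass above average is sparse. -/
theorem measure_hits_le (hX : ∀ i, Measurable (X i)) (hi : iIndepFun X P) (hB : MeasurableSet B)
    (hp : ∀ i ∈ s, P.real (X i ⁻¹' B) = p) (hk : 0 ≤ k) (hβ : 0 ≤ β) (hβ1 : β ≤ 1)
    (hsp : k * (1 + β / 2) - 1 ≤ s.card * p) :
    P.real {ω | hits X B s ω ≤ k} ≤ Real.exp (1 - k * β ^ 2 / 32) := by
  refine (measure_le_le_exp_mul_mgf (t := -(β / 8)) _ (by linarith)
    (integrable_exp_hits hX hB _)).trans ?_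
  refine (mul_le_mul_of_nonneg_left (mgf_hits_le hX hi hB hp _) (Real.exp_pos _).le).trans ?_
  rw [← Real.exp_add, Real.exp_le_exp]
  have h1 := (abs_le.1 (Real.abs_exp_sub_one_sub_id_le (x := -(β / 8))
    (by rw [abs_neg, abs_of_nonneg (by positivity)]; linarith))).2
  have h2 : Real.exp (-(β / 8)) - 1 ≤ -(β / 8 - (β / 8) ^ 2) := by nlinarith
  have h5 : 0 ≤ β / 8 - (β / 8) ^ 2 := by nlinarith
  have h6 : -(β / 8 - (β / 8) ^ 2) ≤ 0 := by linarith
  have hsp0 : 0 ≤ s.card * p := by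
    rcases s.eq_empty_or_nonempty with rfl | ⟨i, his⟩
    · simp
    · rw [← hp i his]
      positivity
  have h3 : s.card * p * (Real.exp (-(β / 8)) - 1) ≤ s.card * p * -(β / 8 - (β / 8) ^ 2) :=
    mul_le_mul_of_nonneg_left h2 hsp0
  have h4 := mul_le_mul_of_nonpos_right hsp h6
  nlinarith [mul_nonneg hk (sq_nonneg β), mul_nonneg (mul_nonneg hk (sq_nonneg β)) hβ,
    mul_nonneg (mul_nonneg hk (sq_nonneg β)) (sub_nonneg.2 hβ1)]

end Chernoff

/-- A bound that holds for each fixed value of `Y` holds for `Y` random, if it is independent of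
the rest. -/
theorem measure_prodMk_mem_le {Ω α γ : Type*} [MeasurableSpace Ω] [MeasurableSpace α]
    [MeasurableSpace γ] {P : Measure Ω} [IsProbabilityMeasure P] {Y : Ω → α} {Z : Ω → γ}
    (hY : Measurable Y) (hZ : Measurable Z) (hYZ : IndepFun Y Z P) {E : Set (α × γ)}
    (hE : MeasurableSet E) {c : ENNReal} (hc : ∀ y, P {ω | (y, Z ω) ∈ E} ≤ c) :
    P {ω | (Y ω, Z ω) ∈ E} ≤ c := by
  have hPY : IsProbabilityMeasure (P.map Y) := Measure.isProbabilityMeasure_map hY.aemeasurable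
  have h1 : P {ω | (Y ω, Z ω) ∈ E} = (P.map fun ω => (Y ω, Z ω)) E :=
    (Measure.map_apply (hY.prodMk hZ) hE).symm
  rw [h1, hYZ.map_prod_eq_prod_map_map hY.aemeasurable hZ.aemeasurable, Measure.prod_apply hE]
  calc _ ≤ ∫⁻ _, c ∂(P.map Y) := lintegral_mono fun y => by
        rw [Measure.map_apply hZ (measurable_prodMk_left hE)]
        exact hc y
    _ = c := by simp

/-! ### The nearest-neighbour mode estimate of a sample -/

theorem knnRadius_le_iff {k : ℝ} {n : ℕ} {x : ℕ → Pt D} {y : Pt D} {ρ : ℝ} (hk : k ≤ n)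
    (hρ : 0 ≤ ρ) : knnRadius k n x y ≤ ρ ↔
      k ≤ (((Finset.range n).filter (fun j => dist (x j) y ≤ ρ)).card : ℝ) := by
  have hbdd : BddBelow {ρ : ℝ | 0 ≤ ρ ∧
      k ≤ (((Finset.range n).filter (fun j => dist (x j) y ≤ ρ)).card : ℝ)} := ⟨0, fun _ h => h.1⟩
  refine ⟨fun h => ?_, fun h => csInf_le hbdd ⟨hρ, h⟩⟩
  -- The number of sample points in a ball is right-continuous in the radius.
  have hev : ∀ᶠ r in 𝓝[>] ρ, ∀ j ∈ Finset.range n, dist (x j) y ≤ r → dist (x j) y ≤ ρ := by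
    refine (Finset.eventually_all _).2 fun j _ => ?_
    rcases le_or_gt (dist (x j) y) ρ with hj | hj
    · exact Eventually.of_forall fun _ _ => hj
    · filter_upwards [Ioo_mem_nhdsGT hj] with r hr hle
      exact absurd hle (not_le.2 hr.2)
  obtain ⟨r, hr, hρr⟩ := (hev.and self_mem_nhdsWithin).exists
  have hne : {ρ : ℝ | 0 ≤ ρ ∧
      k ≤ (((Finset.range n).filter (fun j => dist (x j) y ≤ ρ)).card : ℝ)}.Nonempty := by
    refine ⟨∑ j ∈ Finset.range n, dist (x j) y, Finset.sum_nonneg fun _ _ => dist_nonneg, ?_⟩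
    rw [Finset.filter_true_of_mem fun j hj =>
      Finset.single_le_sum (f := fun j => dist (x j) y) (fun _ _ => dist_nonneg) hj]
    simpa using hk
  obtain ⟨s, hs, hsr⟩ := exists_lt_of_csInf_lt hne (lt_of_le_of_lt h hρr)
  refine hs.2.trans (Nat.cast_le.2 (Finset.card_le_card fun j hj => ?_))
  rw [Finset.mem_filter] at hj ⊢
  exact ⟨hj.1, hr j hj.1 (hj.2.trans hsr.le)⟩

theorem rpow_four_div_le {t : ℕ} (ht : 1 ≤ t) : (t : ℝ) ^ ((4 : ℝ) / (4 + D)) ≤ t := by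
  conv_rhs => rw [← Real.rpow_one (t : ℝ)]
  refine Real.rpow_le_rpow_of_exponent_le (by exact_mod_cast ht) ?_
  rw [div_le_one (by positivity)]
  linarith [Nat.cast_nonneg (α := ℝ) D]

theorem pick_mem_modeCandidates (σ : TieBreak ℕ) {t : ℕ} (ht : 1 ≤ t) (x : ℕ → Pt D) :
    σ.pick (modeCandidates t x) ∈ modeCandidates t x := by
  refine σ.pick_mem _ ?_
  obtain ⟨j, hj, hmin⟩ := (Finset.range t).exists_min_image
    (fun j => knnRadius ((t : ℝ) ^ ((4 : ℝ) / (4 + D))) t x (x j)) ⟨0, Finset.mem_range.2 ht⟩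
  exact ⟨j, by simpa [modeCandidates] using ⟨by simpa using hj, fun i hi => hmin i (by simpa)⟩⟩

/-- If some ball of radius `ρ` around a sample point is crowded, then so is that around the
estimated mode. -/
theorem crowded_empMode (σ : TieBreak ℕ) {t : ℕ} (ht : 1 ≤ t) {x : ℕ → Pt D} {ρ : ℝ} (hρ : 0 ≤ ρ)
    {i : ℕ} (hi : i < t) (hcrowd : (t : ℝ) ^ ((4 : ℝ) / (4 + D)) ≤
      (((Finset.range t).filter (fun j => dist (x j) (x i) ≤ ρ)).card : ℝ)) :
    ∃ i < t, empMode σ t x = x i ∧ (t : ℝ) ^ ((4 : ℝ) / (4 + D)) ≤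
      (((Finset.range t).filter (fun j => dist (x j) (x i) ≤ ρ)).card : ℝ) := by
  have hmem := pick_mem_modeCandidates σ ht x
  rw [modeCandidates, Finset.mem_filter] at hmem
  refine ⟨_, Finset.mem_range.1 hmem.1, rfl, ?_⟩
  rw [← knnRadius_le_iff (rpow_four_div_le ht) hρ] at hcrowd ⊢
  exact (hmem.2 i (by simpa using hi)).trans hcrowd

/-- The number of points of a finite tuple `z` in the closed ball around `y`. -/
noncomputable def tupleCount {s : Finset ℕ} (ρ : ℝ) (y : Pt D) (z : s → Pt D) : ℝ :=
  ∑ i, if dist (z i) y ≤ ρ then 1 else 0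

theorem measurable_tupleCount {s : Finset ℕ} (ρ : ℝ) :
    Measurable fun p : Pt D × (s → Pt D) => tupleCount ρ p.1 p.2 := by
  refine Finset.measurable_sum _ fun i _ => ?_
  refine Measurable.ite (measurableSet_le ?_ measurable_const) measurable_const measurable_const
  fun_prop

theorem tupleCount_eq_hits {Ω : Type*} {X : ℕ → Ω → Pt D} {s : Finset ℕ} (ρ : ℝ) (y : Pt D)
    (ω : Ω) :
    tupleCount ρ y (fun i : s => X i ω) = hits X (Metric.closedBall y ρ) s ω := by
  rw [tupleCount, hits, Finset.sum_apply,
    Finset.sum_coe_sort s fun i => if dist (X i ω) y ≤ ρ then (1 : ℝ) else 0]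
  refine Finset.sum_congr rfl fun i _ => ?_
  by_cases h : dist (X i ω) y ≤ ρ <;> simp [h]

theorem card_filter_eq {Ω : Type*} {X : ℕ → Ω → Pt D} {t j : ℕ} (hj : j < t) {ρ : ℝ}
    (hρ : 0 ≤ ρ) (ω : Ω) :
    (((Finset.range t).filter (fun i => dist (X i ω) (X j ω) ≤ ρ)).card : ℝ) =
      1 + tupleCount ρ (X j ω) (fun i : (Finset.range t).erase j => X i ω) := by
  rw [tupleCount, Finset.sum_coe_sort _ fun i => if dist (X i ω) (X j ω) ≤ ρ then (1 : ℝ) else 0,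
    Finset.card_filter, Nat.cast_sum, ← Finset.add_sum_erase _ _ (Finset.mem_range.2 hj)]
  simp [hρ]

theorem indepFun_erase {Ω : Type*} [MeasurableSpace Ω] {P : Measure Ω} {X : ℕ → Ω → Pt D}
    (hX : ∀ i, Measurable (X i)) (hi : iIndepFun X P) (t j : ℕ) :
    IndepFun (X j) (fun ω (i : (Finset.range t).erase j) => X i ω) P := by
  have h := hi.indepFun_finset {j} ((Finset.range t).erase j) (by simp) hX
  exact h.comp (φ := fun z : ({j} : Finset ℕ) → Pt D => z ⟨j, by simp⟩)
    (measurable_pi_apply (⟨j, by simp⟩ : ({j} : Finset ℕ))) measurable_id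

section Sample

variable {Ω : Type*} [MeasurableSpace Ω] {P : Measure Ω} [IsProbabilityMeasure P]
  {X : ℕ → Ω → Pt D}

/-- Concentration of the mode estimate, for a law under which balls of radius `ρ` centred near
`x₀` carry more mass than those centred at distance more than `ε`: with high probability all
sample points of the first kind see `k` sample points, none of the second kind does, and the first
kind is represented in the sample. -/
theorem measure_lt_dist_empMode_le {μ : Measure (Pt D)} (hX : ∀ i, Measurable (X i))
    (hi : iIndepFun X P) (hlaw : ∀ i, P.map (X i) = μ) (σ : TieBreak ℕ) {t : ℕ} (ht : 1 ≤ t)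
    {ρ ε R β : ℝ} {x₀ : Pt D} (hρ : 0 ≤ ρ) (hβ : 0 ≤ β) (hβ1 : β ≤ 1)
    (hlo : ∀ y, dist y x₀ ≤ ρ → (t : ℝ) ^ ((4 : ℝ) / (4 + D)) * (1 + β / 2) ≤
      t * μ.real (Metric.closedBall y ρ))
    (hhi : ∀ y, ε < dist y x₀ → dist y x₀ ≤ R → t * μ.real (Metric.closedBall y ρ) ≤
      (t : ℝ) ^ ((4 : ℝ) / (4 + D)) * (1 - β))
    (hsupp : μ (Metric.closedBall x₀ R)ᶜ = 0) :
    P {ω | ε < dist (empMode σ t fun s => X s ω) x₀} ≤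
      ENNReal.ofReal (9 * t * Real.exp (-((t : ℝ) ^ ((4 : ℝ) / (4 + D)) * β ^ 2 / 32))) := by
  set k : ℝ := (t : ℝ) ^ ((4 : ℝ) / (4 + D)) with hk
  have hk0 : 0 ≤ k := by positivity
  set b : ℝ := Real.exp (1 - k * β ^ 2 / 32) with hb
  have ht1 : (1 : ℝ) ≤ t := by exact_mod_cast ht
  have hμ : IsProbabilityMeasure μ := by
    rw [← hlaw 0]
    exact Measure.isProbabilityMeasure_map (hX 0).aemeasurable
  have hball : ∀ y : Pt D, MeasurableSet (Metric.closedBall y ρ) :=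
    fun y => Metric.isClosed_closedBall.measurableSet
  have hp : ∀ (y : Pt D) (i : ℕ), P.real (X i ⁻¹' Metric.closedBall y ρ) =
      μ.real (Metric.closedBall y ρ) := by
    intro y i
    rw [measureReal_def, measureReal_def, ← hlaw i, Measure.map_apply (hX i) (hball y)]
  have hcard : ∀ j < t, (((Finset.range t).erase j).card : ℝ) = t - 1 := by
    intro j hj
    rw [Finset.card_erase_of_mem (by simpa using hj), Finset.card_range, Nat.cast_sub ht]
    simp
  have hofReal : ∀ {S : Set Ω}, P.real S ≤ b → P S ≤ ENNReal.ofReal b := by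
    intro S hS
    rw [← ofReal_measureReal (measure_ne_top P S)]
    exact ENNReal.ofReal_le_ofReal hS
  let Z : (j : ℕ) → Ω → ((Finset.range t).erase j → Pt D) := fun j ω i => X i ω
  have hZ : ∀ j, Measurable (Z j) := fun j => measurable_pi_lambda _ fun i => hX i
  have hdist : ∀ {j}, Measurable fun p : Pt D × ((Finset.range t).erase j → Pt D) =>
      dist p.1 x₀ := by
    fun_prop
  have h1 : ∀ j < t, P {ω | dist (X j ω) x₀ ≤ ρ ∧ tupleCount ρ (X j ω) (Z j ω) ≤ k} ≤
      ENNReal.ofReal b := by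
    intro j hj
    refine measure_prodMk_mem_le (hX j) (hZ j) (indepFun_erase hX hi t j)
      (E := {p | dist p.1 x₀ ≤ ρ ∧ tupleCount ρ p.1 p.2 ≤ k}) ?_ fun y => ?_
    · exact (measurableSet_le hdist measurable_const).inter
        (measurableSet_le (measurable_tupleCount ρ) measurable_const)
    · by_cases hy : dist y x₀ ≤ ρ
      · refine hofReal ?_
        simp only [Set.mem_ofPred_eq, hy, true_and, Z, tupleCount_eq_hits]
        refine measure_hits_le hX hi (hball y) (fun i _ => hp y i) hk0 hβ hβ1 ?_
        rw [hcard j hj]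
        have := hlo y hy
        have h3 : μ.real (Metric.closedBall y ρ) ≤ 1 := measureReal_le_one
        linarith
      · simp [hy]
  have h2 : ∀ j < t, P {ω | (ε < dist (X j ω) x₀ ∧ dist (X j ω) x₀ ≤ R) ∧
      k - 1 ≤ tupleCount ρ (X j ω) (Z j ω)} ≤ ENNReal.ofReal b := by
    intro j hj
    refine measure_prodMk_mem_le (hX j) (hZ j) (indepFun_erase hX hi t j)
      (E := {p | (ε < dist p.1 x₀ ∧ dist p.1 x₀ ≤ R) ∧ k - 1 ≤ tupleCount ρ p.1 p.2}) ?_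
      fun y => ?_
    · exact ((measurableSet_lt measurable_const hdist).inter
        (measurableSet_le hdist measurable_const)).inter
        (measurableSet_le measurable_const (measurable_tupleCount ρ))
    · by_cases hy : ε < dist y x₀ ∧ dist y x₀ ≤ R
      · refine hofReal ?_
        simp only [Set.mem_ofPred_eq, hy, true_and, Z, tupleCount_eq_hits]
        refine measure_le_hits hX hi (hball y) (fun i _ => hp y i) hk0 hβ hβ1 ?_
        rw [hcard j hj]
        have := hhi y hy.1 hy.2
        have h3 : 0 ≤ μ.real (Metric.closedBall y ρ) := measureReal_nonneg
        linarith
      · simp [hy]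
  have h3 : P {ω | hits X (Metric.closedBall x₀ ρ) (Finset.range t) ω ≤ k} ≤
      ENNReal.ofReal b := by
    refine hofReal (measure_hits_le hX hi (hball x₀) (fun i _ => hp x₀ i) hk0 hβ hβ1 ?_)
    have := hlo x₀ (by simpa using hρ)
    rw [Finset.card_range]
    linarith
  have h4 : ∀ j, P {ω | ¬ dist (X j ω) x₀ ≤ R} = 0 := by
    intro j
    rw [← hlaw j, Measure.map_apply (hX j) Metric.isClosed_closedBall.measurableSet.compl] at hsupp
    rw [← hsupp]
    congr 1
  have hsub : {ω | ε < dist (empMode σ t fun s => X s ω) x₀} ⊆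
      (((⋃ j ∈ Finset.range t, {ω | dist (X j ω) x₀ ≤ ρ ∧ tupleCount ρ (X j ω) (Z j ω) ≤ k}) ∪
        ⋃ j ∈ Finset.range t, {ω | (ε < dist (X j ω) x₀ ∧ dist (X j ω) x₀ ≤ R) ∧
          k - 1 ≤ tupleCount ρ (X j ω) (Z j ω)}) ∪
        {ω | hits X (Metric.closedBall x₀ ρ) (Finset.range t) ω ≤ k}) ∪
        ⋃ j ∈ Finset.range t, {ω | ¬ dist (X j ω) x₀ ≤ R} := by
    intro ω hω
    by_contra hcon
    simp only [Set.mem_union, Set.mem_iUnion, Set.mem_ofPred_eq, not_or, not_exists, not_and,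
      not_le, Finset.mem_range] at hcon
    obtain ⟨⟨⟨c1, c2⟩, c3⟩, c4⟩ := hcon
    -- Some sample point is close to the mode, as the ball around the mode is hit.
    obtain ⟨i, hit, hiρ⟩ : ∃ i < t, dist (X i ω) x₀ ≤ ρ := by
      by_contra! hno
      refine absurd c3 (not_lt.2 (le_trans (le_of_eq ?_) hk0))
      rw [hits, Finset.sum_apply]
      refine Finset.sum_eq_zero fun i hi => ?_
      simp [hno i (by simpa using hi)]
    obtain ⟨j, hjt, hj, hjk⟩ := crowded_empMode σ ht hρ hit (x := fun s => X s ω) (by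
      rw [card_filter_eq hit hρ]
      linarith [c1 i hit hiρ])
    rw [card_filter_eq hjt hρ, ← hk] at hjk
    rw [Set.mem_ofPred_eq, hj] at hω
    linarith [c2 j hjt ⟨hω, not_lt.1 (c4 j hjt)⟩]
  have hsum : ∀ (S : ℕ → Set Ω), (∀ j < t, P (S j) ≤ ENNReal.ofReal b) →
      P (⋃ j ∈ Finset.range t, S j) ≤ ENNReal.ofReal (t * b) := by
    intro S hS
    refine (measure_biUnion_finset_le _ _).trans ?_
    refine (Finset.sum_le_sum fun j hj => hS j (by simpa using hj)).trans ?_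
    rw [Finset.sum_const, Finset.card_range, nsmul_eq_mul, ENNReal.ofReal_mul (by positivity)]
    simp
  have hnull : P (⋃ j ∈ Finset.range t, {ω | ¬ dist (X j ω) x₀ ≤ R}) = 0 :=
    (measure_biUnion_null_iff (Finset.countable_toSet _)).2 fun j _ => h4 j
  have hb0 : 0 < b := Real.exp_pos _
  calc _ ≤ _ := measure_mono hsub
    _ ≤ ENNReal.ofReal (t * b) + ENNReal.ofReal (t * b) + ENNReal.ofReal b + 0 := by
      refine (measure_union_le _ _).trans (add_le_add ?_ hnull.le)
      refine (measure_union_le _ _).trans (add_le_add ?_ h3)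
      exact (measure_union_le _ _).trans (add_le_add (hsum _ h1) (hsum _ h2))
    _ = ENNReal.ofReal (t * b + t * b + b) := by
      rw [add_zero, ← ENNReal.ofReal_add (by positivity) (by positivity),
        ← ENNReal.ofReal_add (by positivity) (by positivity)]
    _ ≤ _ := by
      refine ENNReal.ofReal_le_ofReal ?_
      have h5 : b ≤ 3 * Real.exp (-(k * β ^ 2 / 32)) := by
        rw [hb, sub_eq_add_neg, Real.exp_add]
        gcongr
        linarith [Real.exp_one_lt_d9]
      have h6 := Real.exp_pos (-(k * β ^ 2 / 32))
      nlinarith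

end Sample

/-! ### Confidence radii -/

/-- The constant `c` of the confidence radius is of order at least `1 / N₀`, so that
`log (c t²)` is of order `log t` for `t ≥ N₀`. -/
theorem tail_sum_bounds {N₀ : ℕ} (hN : 1 ≤ N₀) :
    1 / (4 * N₀ : ℝ) ≤ ∑' i : ℕ, 1 / ((N₀ + i : ℕ) : ℝ) ^ 2 ∧
      ∑' i : ℕ, 1 / ((N₀ + i : ℕ) : ℝ) ^ 2 ≤ 2 := by
  have hN' : (1 : ℝ) ≤ N₀ := by exact_mod_cast hN
  have hs : Summable fun i : ℕ => 1 / (i : ℝ) ^ 2 := Real.summable_one_div_nat_pow.2 one_lt_two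
  have hs' : ∀ M : ℕ, Summable fun i : ℕ => 1 / ((M + i : ℕ) : ℝ) ^ 2 :=
    fun M => hs.comp_injective (add_right_injective M)
  constructor
  · refine le_trans ?_ ((hs' N₀).sum_le_tsum (Finset.range N₀) fun i _ => by positivity)
    calc 1 / (4 * N₀ : ℝ) = ∑ _i ∈ Finset.range N₀, 1 / (2 * N₀ : ℝ) ^ 2 := by
          rw [Finset.sum_const, Finset.card_range, nsmul_eq_mul]
          field_simp
          norm_num
      _ ≤ _ := by
          refine Finset.sum_le_sum fun i hi => ?_
          have : (i : ℝ) ≤ N₀ := by exact_mod_cast (Finset.mem_range.1 hi).le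
          push_cast
          gcongr
          linarith
  · calc _ ≤ ∑' i : ℕ, 1 / ((1 + i : ℕ) : ℝ) ^ 2 := by
          refine (hs' N₀).tsum_le_tsum (fun i => ?_) (hs' 1)
          gcongr
      _ = ∑' i : ℕ, 1 / (i : ℝ) ^ 2 := by
          rw [hs.tsum_eq_zero_add]
          simp [add_comm]
      _ = Real.pi ^ 2 / 6 := hasSum_zeta_two.tsum_eq
      _ ≤ 2 := by nlinarith [Real.pi_lt_d2, Real.pi_pos]

theorem half_le_confRadius {N₀ t : ℕ} (hN : 1 ≤ N₀) (ht : N₀ ≤ t) (ht16 : 16 ≤ t) (δ : ℝ) :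
    (Real.log t / 2 + Real.log (1 / δ)) * (Real.log t / (t : ℝ) ^ ((1 : ℝ) / (4 + D))) ≤
      confRadius D N₀ t δ := by
  have ht' : (16 : ℝ) ≤ t := by exact_mod_cast ht16
  have hN' : (1 : ℝ) ≤ N₀ := by exact_mod_cast hN
  have htN : (N₀ : ℝ) ≤ t := by exact_mod_cast ht
  have hlog : 0 ≤ Real.log t := Real.log_nonneg (by linarith)
  refine mul_le_mul_of_nonneg_right (add_le_add_left ?_ _) (by positivity)
  have h1 : Real.log t / 2 = Real.log (√t) := (Real.log_sqrt (by positivity)).symm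
  rw [h1]
  refine Real.log_le_log (by positivity) ?_
  have h2 : √(t : ℝ) ≤ t / 4 := by
    rw [Real.sqrt_le_left (by positivity)]
    nlinarith
  refine h2.trans (le_trans ?_ (mul_le_mul_of_nonneg_right (tail_sum_bounds hN).1 (sq_nonneg _)))
  rw [div_mul_eq_mul_div, div_le_div_iff₀ (by positivity) (by positivity)]
  nlinarith

theorem confRadius_le {N₀ t : ℕ} (hN : 1 ≤ N₀) (ht : N₀ ≤ t) (δ : ℝ) :
    confRadius D N₀ t δ ≤ (2 * Real.log t + (1 + Real.log (1 / δ))) *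
      (Real.log t / (t : ℝ) ^ ((1 : ℝ) / (4 + D))) := by
  have hN' : (1 : ℝ) ≤ N₀ := by exact_mod_cast hN
  have ht' : (1 : ℝ) ≤ t := by exact_mod_cast hN.trans ht
  have hlog : 0 ≤ Real.log t := Real.log_nonneg ht'
  refine mul_le_mul_of_nonneg_right ?_ (by positivity)
  have hc : 0 < ∑' i : ℕ, 1 / ((N₀ + i : ℕ) : ℝ) ^ 2 :=
    lt_of_lt_of_le (by positivity) (tail_sum_bounds hN).1
  rw [Real.log_mul hc.ne' (by positivity), Real.log_pow]
  have h2 := Real.log_le_log hc (tail_sum_bounds hN).2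
  have h3 := Real.log_two_lt_d9
  push_cast at h2 ⊢
  linarith

theorem confRadius_anti {N₀ t : ℕ} {δ δ' : ℝ} (ht : 1 ≤ t) (hδ : 0 < δ) (hδδ' : δ ≤ δ') :
    confRadius D N₀ t δ' ≤ confRadius D N₀ t δ := by
  have ht' : (1 : ℝ) ≤ t := by exact_mod_cast ht
  have hlog : 0 ≤ Real.log t := Real.log_nonneg ht'
  refine mul_le_mul_of_nonneg_right (add_le_add_right ?_ _) (by positivity)
  exact Real.log_le_log (by have := hδ.trans_le hδδ'; positivity) (by gcongr)

/-- In terms of `τ = t^{1/(4+D)}` one has `t = τ^{4+D}`, and `k = τ⁴`. -/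
theorem root_spec (D : ℕ) {t : ℕ} (ht : 1 ≤ t) :
    1 ≤ (t : ℝ) ^ ((1 : ℝ) / (4 + D)) ∧
    (t : ℝ) = ((t : ℝ) ^ ((1 : ℝ) / (4 + D))) ^ 4 * ((t : ℝ) ^ ((1 : ℝ) / (4 + D))) ^ D ∧
    (t : ℝ) ^ ((4 : ℝ) / (4 + D)) = ((t : ℝ) ^ ((1 : ℝ) / (4 + D))) ^ 4 := by
  have ht' : (1 : ℝ) ≤ t := by exact_mod_cast ht
  refine ⟨Real.one_le_rpow ht' (by positivity), ?_, ?_⟩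
  · rw [← pow_add, ← Real.rpow_natCast, ← Real.rpow_mul (by positivity)]
    push_cast
    rw [one_div_mul_cancel (by positivity), Real.rpow_one]
  · rw [← Real.rpow_natCast, ← Real.rpow_mul (by positivity)]
    congr 1
    push_cast
    ring

theorem tendsto_root (D : ℕ) :
    Tendsto (fun t : ℕ => (t : ℝ) ^ ((1 : ℝ) / (4 + D))) atTop atTop :=
  (tendsto_rpow_atTop (by positivity)).comp tendsto_natCast_atTop_atTop

/-- The failure probability of the mode estimate: the square in the exponent beats every multiple of
`log t + log (1/d)`, and five times that suffices. -/
theorem exp_tail_le {t : ℕ} {d : ℝ} (hd : 0 < d) (hd1 : d ≤ 1) (ht : 160 ≤ Real.log t) :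
    9 * t * Real.exp (-((Real.log t + Real.log (1 / d)) * Real.log t) ^ 2 / 32) ≤
      d / (t : ℝ) ^ 2 := by
  have ht0 : 0 < (t : ℝ) := by
    rcases Nat.eq_zero_or_pos t with rfl | h
    · norm_num at ht
    · exact_mod_cast h
  have ht3 : (3 : ℝ) ≤ t := by linarith [Real.log_le_sub_one_of_pos ht0]
  have hld : 0 ≤ Real.log (1 / d) := Real.log_nonneg (by rw [le_div_iff₀ hd]; linarith)
  set lam := Real.log t + Real.log (1 / d) with hlam
  have h1 : -(lam * Real.log t) ^ 2 / 32 ≤ -(5 * lam) := by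
    have h2 : 160 * lam ≤ (lam * Real.log t) * (lam * Real.log t) := by
      have h3 : lam ≤ lam * Real.log t := by nlinarith
      have h4 : 160 ≤ lam * Real.log t := by nlinarith
      nlinarith
    nlinarith
  have hexp : Real.exp (-lam) = d / t := by
    rw [Real.exp_neg, hlam, Real.exp_add, Real.exp_log ht0, Real.exp_log (by positivity)]
    field_simp
  calc _ ≤ 9 * t * Real.exp (-(5 * lam)) := by gcongr
    _ = 9 * t * (d / t) ^ 5 := by
      rw [← hexp, ← Real.exp_nat_mul]
      congr 2
      push_cast
      ring
    _ = d * (9 * d ^ 4 / t ^ 4) := by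
      field_simp
    _ ≤ d * (t ^ 2 / t ^ 4) := by
      gcongr
      have : d ^ 4 ≤ 1 := pow_le_one₀ hd.le hd1
      nlinarith
    _ = d / (t : ℝ) ^ 2 := by field_simp

/-! ### Concentration of the mode estimate -/

/-- The radius `ρ` for which a ball of constant density `f₀` has mass `(1 + w / τ²) k / t`. It is
small enough for the parabolas to be compared on balls of this radius. -/
theorem exists_radius {v f₀ B r a M w τ : ℝ} (hD : 0 < D) (hv : 0 < v) (hf₀ : 0 < f₀)
    (hM : 0 < M) (hw : 0 < w) (hτ : 0 < τ) (hwτ : w ≤ τ ^ 2)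
    (h1 : 16 * B * ((2 / (v * f₀)) ^ ((1 : ℝ) / D)) ^ 2 ≤ w * f₀)
    (h2 : 4 * M * (2 / (v * f₀)) ^ ((1 : ℝ) / D) ≤ w) (h3 : 32 * M ^ 2 * f₀ ≤ w * a)
    (h4 : 2 * (2 / (v * f₀)) ^ ((1 : ℝ) / D) ≤ τ * r) (h5 : (2 / (v * f₀)) ^ ((1 : ℝ) / D) ≤ τ) :
    ∃ ρ > 0, ρ ^ D * v * f₀ * τ ^ D = 1 + w / τ ^ 2 ∧ ρ ≤ w / (2 * M * τ) / 2 ∧ ρ ≤ 1 ∧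
      2 * ρ ≤ r ∧ 4 * B * ρ ^ 2 ≤ f₀ * (w / τ ^ 2 / 4) ∧
      2 * (w / τ ^ 2) * f₀ ≤ a * (w / (2 * M * τ)) ^ 2 / 4 := by
  have hDne : (D : ℝ) ≠ 0 := by exact_mod_cast hD.ne'
  have hβ1 : w / τ ^ 2 ≤ 1 := by rwa [div_le_one (by positivity)]
  set κ : ℝ := (2 / (v * f₀)) ^ ((1 : ℝ) / D)
  set c : ℝ := ((1 + w / τ ^ 2) / (v * f₀)) ^ ((1 : ℝ) / D) with hc
  have hc0 : 0 < c := by positivity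
  have hcκ : c ≤ κ := by
    rw [hc]
    refine Real.rpow_le_rpow (by positivity) ?_ (by positivity)
    gcongr
    linarith
  have hcD : c ^ D = (1 + w / τ ^ 2) / (v * f₀) := by
    rw [hc, ← Real.rpow_natCast (_ ^ _), ← Real.rpow_mul (by positivity),
      one_div_mul_cancel hDne, Real.rpow_one]
  refine ⟨c / τ, by positivity, ?_, ?_, ?_, ?_, ?_, ?_⟩
  · rw [div_pow, hcD]
    field_simp
  · rw [div_div, div_le_div_iff₀ hτ (by positivity)]
    have : 4 * M * c ≤ w := (mul_le_mul_of_nonneg_left hcκ (by positivity)).trans h2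
    have := mul_le_mul_of_nonneg_right this hτ.le
    linarith
  · rw [div_le_one hτ]
    exact hcκ.trans h5
  · rw [← mul_div_assoc, div_le_iff₀ hτ, mul_comm r]
    linarith
  · have h6 : 16 * B * c ^ 2 ≤ w * f₀ := by
      rcases le_or_gt B 0 with hB | hB
      · have h7 : 0 < w * f₀ := by positivity
        have h8 : 16 * B * c ^ 2 ≤ 0 := mul_nonpos_of_nonpos_of_nonneg (by linarith) (sq_nonneg c)
        linarith
      · refine le_trans ?_ h1
        gcongr
    rw [div_pow, ← mul_div_assoc, ← mul_div_assoc, ← mul_div_assoc, div_le_div_iff₀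
      (by positivity) (by positivity), div_mul_cancel₀ _ (by positivity)]
    linarith
  · have h7 : a * (w / (2 * M * τ)) ^ 2 / 4 - 2 * (w / τ ^ 2) * f₀ =
        (w * a - 32 * M ^ 2 * f₀) * (w / (16 * M ^ 2 * τ ^ 2)) := by
      field_simp
      ring
    have h8 : 0 ≤ (w * a - 32 * M ^ 2 * f₀) * (w / (16 * M ^ 2 * τ ^ 2)) :=
      mul_nonneg (by linarith) (by positivity)
    linarith

/-- Balls centred near the mode have an expected number of sample points clearly above `k`, by the
lower parabola. -/
theorem le_mul_rewardLaw {f : Pt D → ℝ} {x₀ y : Pt D} [IsProbabilityMeasure (rewardLaw f)]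
    {B r t k β ρ : ℝ} (hB : 0 ≤ B)
    (hlow : ∀ x, dist x x₀ ≤ r → f x₀ - B * dist x x₀ ^ 2 ≤ f x) (ht : 0 ≤ t)
    (htρ : t * (ρ ^ D * unitBallVol D) * f x₀ = k * (1 + β)) (hf₀ : 0 < f x₀) (hρ : 0 ≤ ρ)
    (hβ : 0 ≤ β) (hβ1 : β ≤ 1) (hρr : 2 * ρ ≤ r) (hρβ : 4 * B * ρ ^ 2 ≤ f x₀ * (β / 4))
    (hy : dist y x₀ ≤ ρ) :
    k * (1 + β / 2) ≤ t * (rewardLaw f).real (Metric.closedBall y ρ) := by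
  have hv := unitBallVol_pos D
  have hmass := le_rewardLaw_closedBall (f := f) (y := y) (M := f x₀ - 4 * B * ρ ^ 2) hρ
    fun x hx => by
      have h1 : dist x x₀ ≤ 2 * ρ := by linarith [dist_triangle x y x₀]
      refine le_trans ?_ (hlow x (h1.trans hρr))
      have h2 : B * dist x x₀ ^ 2 ≤ B * (2 * ρ) ^ 2 := by gcongr
      linarith
  rw [← ofReal_measureReal (measure_ne_top _ _),
    ENNReal.ofReal_le_ofReal_iff measureReal_nonneg] at hmass
  have htρ0 : 0 ≤ t * (ρ ^ D * unitBallVol D) := by positivity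
  have hk : 0 ≤ k := by
    refine nonneg_of_mul_nonneg_left (b := 1 + β) ?_ (by linarith)
    rw [← htρ]
    positivity
  calc k * (1 + β / 2) ≤ k * ((1 + β) * (1 - β / 4)) := by
        gcongr
        nlinarith
    _ = t * (ρ ^ D * unitBallVol D) * (f x₀ - f x₀ * (β / 4)) := by
        linear_combination (-(1 - β / 4)) * htρ
    _ ≤ t * (ρ ^ D * unitBallVol D) * (f x₀ - 4 * B * ρ ^ 2) := by gcongr
    _ = t * ((f x₀ - 4 * B * ρ ^ 2) * (ρ ^ D * unitBallVol D)) := by ring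
    _ ≤ _ := by gcongr

/-- Balls centred far from the mode have an expected number of sample points clearly below `k`, by
the upper parabola. -/
theorem mul_rewardLaw_le {f : Pt D → ℝ} {x₀ y : Pt D} [IsProbabilityMeasure (rewardLaw f)]
    (h : IsTopMode f x₀) {a R t k β ρ ε : ℝ} (ha : 0 ≤ a)
    (hup : ∀ x, dist x x₀ ≤ R + 1 → f x ≤ f x₀ - a * dist x x₀ ^ 2) (ht : 0 ≤ t)
    (htρ : t * (ρ ^ D * unitBallVol D) * f x₀ = k * (1 + β)) (hρ : 0 ≤ ρ) (hε : 0 ≤ ε)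
    (hβ : 0 ≤ β) (hρ1 : ρ ≤ 1) (hρε : ρ ≤ ε / 2) (hεβ : 2 * β * f x₀ ≤ a * ε ^ 2 / 4)
    (hy : ε < dist y x₀) (hyR : dist y x₀ ≤ R) :
    t * (rewardLaw f).real (Metric.closedBall y ρ) ≤ k * (1 - β) := by
  have hv := unitBallVol_pos D
  have hmass := rewardLaw_closedBall_le (f := f) (y := y) (M := f x₀ - a * ε ^ 2 / 4) hρ
    fun x hx => by
      have h1 : dist x x₀ ≤ R + 1 := by linarith [dist_triangle x y x₀]
      refine (hup x h1).trans ?_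
      have h3 : ε / 2 ≤ dist x x₀ := by linarith [dist_triangle_left y x₀ x]
      have h2 : a * (ε / 2) ^ 2 ≤ a * dist x x₀ ^ 2 := by gcongr
      linarith
  have hf₀ : 0 ≤ f x₀ := h.nonneg x₀
  have hM0 : 0 ≤ f x₀ - a * ε ^ 2 / 4 := by
    have h1 := hup y (by linarith)
    have h2 := h.nonneg y
    have h3 : a * ε ^ 2 ≤ a * dist y x₀ ^ 2 := by gcongr
    have h4 : 0 ≤ a * ε ^ 2 := by positivity
    linarith
  rw [← ofReal_measureReal (measure_ne_top _ _), ENNReal.ofReal_le_ofReal_iff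
    (by positivity)] at hmass
  have htρ0 : 0 ≤ t * (ρ ^ D * unitBallVol D) := by positivity
  have hk : 0 ≤ k := by
    refine nonneg_of_mul_nonneg_left (b := 1 + β) ?_ (by linarith)
    rw [← htρ]
    positivity
  calc _ ≤ t * ((f x₀ - a * ε ^ 2 / 4) * (ρ ^ D * unitBallVol D)) := by gcongr
    _ = t * (ρ ^ D * unitBallVol D) * (f x₀ - a * ε ^ 2 / 4) := by ring
    _ ≤ t * (ρ ^ D * unitBallVol D) * (f x₀ - 2 * β * f x₀) := by gcongr
    _ = k * ((1 + β) * (1 - 2 * β)) := by linear_combination (1 - 2 * β) * htρ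
    _ ≤ _ := by
      gcongr
      nlinarith

/-- For densities between two parabolas, the mode estimate of a large sample is at distance more
than `(log t + log (1/d)) log t / (2 M t^{1/(4+D)})` from the mode with probability at most
`d / t²`. -/
theorem eventually_measure_lt_dist_empMode_le.{u} {f : Pt D → ℝ} {x₀ : Pt D}
    (h : IsTopMode f x₀) (hD : 0 < D) {M : ℝ} (hM : 0 < M) :
    ∀ᶠ t : ℕ in atTop, ∀ d : ℝ, 0 < d → d ≤ 1 → ∀ (Ω : Type u) [MeasurableSpace Ω]
      (P : Measure Ω) [IsProbabilityMeasure P] (X : ℕ → Ω → Pt D) (σ : TieBreak ℕ),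
      (∀ i, Measurable (X i)) → iIndepFun X P → (∀ i, P.map (X i) = rewardLaw f) →
      P {ω | (Real.log t + Real.log (1 / d)) * Real.log t /
          (2 * M * (t : ℝ) ^ ((1 : ℝ) / (4 + D))) < dist (empMode σ t fun s => X s ω) x₀} ≤
        ENNReal.ofReal (d / (t : ℝ) ^ 2) := by
  obtain ⟨B, r, a, R, hB, hr, ha, hR, hlow, hup, hsupp⟩ := h.exists_parabolas hD
  have hf0 := h.pos hD
  set f₀ := f x₀
  have hv := unitBallVol_pos D
  set v := unitBallVol D
  set κ : ℝ := (2 / (v * f₀)) ^ ((1 : ℝ) / D) with hκ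
  have hκ0 : 0 < κ := by positivity
  have hlogt : Tendsto (fun t : ℕ => Real.log t) atTop atTop :=
    Real.tendsto_log_atTop.comp tendsto_natCast_atTop_atTop
  filter_upwards [hlogt.eventually_ge_atTop (16 * B * κ ^ 2 / f₀),
    hlogt.eventually_ge_atTop (4 * M * κ), hlogt.eventually_ge_atTop (32 * M ^ 2 * f₀ / a),
    hlogt.eventually_ge_atTop 160, (tendsto_root D).eventually_ge_atTop (2 * M * R),
    (tendsto_root D).eventually_ge_atTop (2 * κ / r), (tendsto_root D).eventually_ge_atTop κ,
    eventually_ge_atTop 1] with t hℓ1 hℓ2 hℓ3 hℓ4 hτ1 hτ2 hτ3 ht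
  intro d hd hd1 Ω _ P _ X σ hX hi hlaw
  obtain ⟨hτ, htτ, hkτ⟩ := root_spec D ht
  set τ : ℝ := (t : ℝ) ^ ((1 : ℝ) / (4 + D))
  have hτ0 : 0 < τ := by linarith
  set ℓ : ℝ := Real.log t
  have hld : 0 ≤ Real.log (1 / d) := Real.log_nonneg (by rw [le_div_iff₀ hd]; linarith)
  set lam : ℝ := ℓ + Real.log (1 / d) with hlam
  -- The choice of the radii below only uses that the product `lam * ℓ` is large.
  have hw : ℓ ≤ lam * ℓ := by nlinarith
  set w : ℝ := lam * ℓ with hw_def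
  have hw0 : 0 < w := by linarith
  set ε : ℝ := w / (2 * M * τ) with hε
  have hε0 : 0 < ε := by positivity
  rcases le_or_gt R ε with hRε | hRε
  -- Beyond the support there are almost surely no sample points.
  · have hnull : ∀ j, P {ω | R < dist (X j ω) x₀} = 0 := by
      intro j
      have h1 := rewardLaw_compl_closedBall hsupp
      rw [← hlaw j, Measure.map_apply (hX j) Metric.isClosed_closedBall.measurableSet.compl] at h1
      rw [← h1]
      congr 1
      ext ω
      simp
    refine le_trans (le_of_eq (measure_mono_null (t := ⋃ j, {ω | R < dist (X j ω) x₀}) ?_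
      (measure_iUnion_null hnull))) zero_le
    intro ω hω
    exact Set.mem_iUnion.2 ⟨_, hRε.trans_lt hω⟩
  set β : ℝ := w / τ ^ 2 with hβ
  have hβ0 : 0 < β := by positivity
  have hβ1 : β ≤ 1 := by
    have : w < R * (2 * M * τ) := (div_lt_iff₀ (by positivity)).1 hRε
    rw [hβ, div_le_one (by positivity)]
    nlinarith
  obtain ⟨ρ, hρ0, hρD, hρε, hρ1, hρr, hρβ, hεβ⟩ := exists_radius (τ := τ) (w := w) (B := B)
    (a := a) (r := r) hD hv hf0 hM hw0 hτ0 (by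
      rw [hβ, div_le_one (by positivity)] at hβ1
      exact hβ1) (((div_le_iff₀ hf0).1 hℓ1).trans (by gcongr)) (hℓ2.trans hw)
    (((div_le_iff₀ ha).1 hℓ3).trans (by gcongr)) ((div_le_iff₀ hr).1 hτ2) hτ3
  have hμ : IsProbabilityMeasure (rewardLaw f) := by
    rw [← hlaw 0]
    exact Measure.isProbabilityMeasure_map (hX 0).aemeasurable
  have htρ : (t : ℝ) * (ρ ^ D * v) * f₀ = τ ^ 4 * (1 + β) := by
    rw [← hρD, htτ]
    ring
  have ht0 : (0 : ℝ) < t := by exact_mod_cast ht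
  refine (measure_lt_dist_empMode_le (R := R) hX hi hlaw σ ht hρ0.le hβ0.le hβ1 ?_ ?_
    (rewardLaw_compl_closedBall hsupp)).trans ?_
  · intro y hy
    rw [hkτ]
    exact le_mul_rewardLaw hB.le hlow ht0.le htρ hf0 hρ0.le hβ0.le hβ1 hρr hρβ hy
  · intro y hy hyR
    rw [hkτ]
    exact mul_rewardLaw_le h ha.le hup ht0.le htρ hρ0.le hε0.le hβ0.le hρ1 hρε hεβ hy hyR
  · refine ENNReal.ofReal_le_ofReal (le_trans (le_of_eq ?_) (exp_tail_le hd hd1 hℓ4))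
    rw [hkτ]
    congr 2
    rw [← hlam, ← hw_def, hβ]
    field_simp

/-- The confidence radius covers the error of the estimated score, except with probability
`d / t²`, once the sample is large, in terms of the density and the Lipschitz constant. -/
theorem exists_forall_measure_confRadius_lt_le.{u} {f : Pt D → ℝ} {x₀ : Pt D}
    (h : IsTopMode f x₀) (hD : 0 < D) (L : NNReal) :
    ∃ N : ℕ, ∀ N₀ ≥ N, ∀ t ≥ N₀, ∀ d : ℝ, 0 < d → d ≤ 1 →
      ∀ (Ω : Type u) [MeasurableSpace Ω]
      (P : Measure Ω) [IsProbabilityMeasure P] (X : ℕ → Ω → Pt D) (σ : TieBreak ℕ)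
      (score : Pt D → ℝ), LipschitzWith L score →
      (∀ i, Measurable (X i)) → iIndepFun X P → (∀ i, P.map (X i) = rewardLaw f) →
      P {ω | confRadius D N₀ t d < |score (empMode σ t fun s => X s ω) - score x₀|} ≤
        ENNReal.ofReal (d / (t : ℝ) ^ 2) := by
  obtain ⟨N, hN⟩ := eventually_atTop.1
    (eventually_measure_lt_dist_empMode_le h hD (M := L + 1) (by positivity))
  refine ⟨max N 16, fun N₀ hN₀ t ht d hd hd1 Ω _ P _ X σ score hL hX hi hlaw => ?_⟩
  have ht16 : 16 ≤ t := ((le_max_right _ _).trans hN₀).trans ht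
  refine (measure_mono fun ω hω => ?_).trans
    (hN t (((le_max_left _ _).trans hN₀).trans ht) d hd hd1 Ω P X σ hX hi hlaw)
  have hω' : confRadius D N₀ t d < |score (empMode σ t fun s => X s ω) - score x₀| := hω
  have ht1 : (1 : ℝ) ≤ t := by exact_mod_cast (by omega : 1 ≤ t)
  have h1 := half_le_confRadius (D := D) (N₀ := N₀) (t := t)
    (by have := (le_max_right N 16).trans hN₀; omega) ht ht16 d
  have h2 := hL.dist_le_mul (empMode σ t fun s => X s ω) x₀
  rw [Real.dist_eq] at h2
  have hlog : 0 ≤ Real.log t := Real.log_nonneg ht1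
  have hld : 0 ≤ Real.log (1 / d) := Real.log_nonneg (by rw [le_div_iff₀ hd]; linarith)
  have hτ0 : 0 < (t : ℝ) ^ ((1 : ℝ) / (4 + D)) := by positivity
  have h3 : (Real.log t + Real.log (1 / d)) / 2 * (Real.log t / (t : ℝ) ^ ((1 : ℝ) / (4 + D))) ≤
      (Real.log t / 2 + Real.log (1 / d)) * (Real.log t / (t : ℝ) ^ ((1 : ℝ) / (4 + D))) := by
    gcongr
    linarith
  have h4 : (Real.log t + Real.log (1 / d)) / 2 * (Real.log t / (t : ℝ) ^ ((1 : ℝ) / (4 + D))) =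
      (L + 1) * ((Real.log t + Real.log (1 / d)) * Real.log t /
          (2 * (L + 1) * (t : ℝ) ^ ((1 : ℝ) / (4 + D)))) := by
    have : (0 : ℝ) < L + 1 := by positivity
    field_simp
  have h5 : (L : ℝ) * dist (empMode σ t fun s => X s ω) x₀ ≤
      (L + 1) * dist (empMode σ t fun s => X s ω) x₀ := by
    gcongr
    linarith
  have h6 : (0 : ℝ) < L + 1 := by positivity
  refine lt_of_mul_lt_mul_left ?_ h6.le
  linarith

/-! ### Correctness of the algorithm and the gaps of the critical arms -/

/-- The set `{1, …, m}` of the top arms, indexed from `0`. -/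
def topSet (K m : ℕ) : Finset (Fin K) := Finset.univ.filter fun i : Fin K => (i : ℕ) < m

theorem mem_topSet {K m : ℕ} {i : Fin K} : i ∈ topSet K m ↔ (i : ℕ) < m := by
  simp [topSet]

theorem card_topSet {K m : ℕ} (hmK : m ≤ K) : (topSet K m).card = m := by
  simp [topSet, Fin.card_filter_val_lt, hmK]

theorem exists_top_subset {K : ℕ} (v : Fin K → ℝ) {m : ℕ} (hm : m ≤ K) :
    ∃ S : Finset (Fin K), S.card = m ∧ ∀ i ∈ S, ∀ j ∉ S, v j ≤ v i := by
  induction m with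
  | zero => exact ⟨∅, by simp⟩
  | succ m ih =>
    obtain ⟨S, hS, hv⟩ := ih (by omega)
    have hne : Sᶜ.Nonempty := by
      rw [← Finset.card_pos, Finset.card_compl, Fintype.card_fin]
      omega
    obtain ⟨j, hj, hmax⟩ := Sᶜ.exists_max_image v hne
    rw [Finset.mem_compl] at hj
    refine ⟨insert j S, by rw [Finset.card_insert_of_notMem hj, hS], fun i hi j' hj' => ?_⟩
    rw [Finset.mem_insert, not_or] at hj'
    rcases Finset.mem_insert.1 hi with rfl | hi
    · exact hmax j' (by simpa using hj'.2)
    · exact hv i hi j' hj'.2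

section Gaps

variable {K m : ℕ} {θ : Fin K → ℝ} (hm : 0 < m) (hmK : m < K)

include hmK in
theorem theta_le_of_le (hθ : Antitone θ) {i : Fin K} (hi : m ≤ i) : θ i ≤ θ ⟨m, hmK⟩ :=
  hθ (Fin.mk_le_of_le_val hi)

theorem le_theta_of_lt (hθ : Antitone θ) {i : Fin K} (hi : (i : ℕ) < m) :
    θ ⟨m - 1, by omega⟩ ≤ θ i :=
  hθ (Fin.le_def.2 (by simp; omega))

theorem gap_of_lt (hθ : Antitone θ) {i : Fin K} (hi : (i : ℕ) < m) :
    gap θ m hm hmK i = θ i - θ ⟨m, hmK⟩ :=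
  if_pos (le_theta_of_lt hm hmK hθ hi)

theorem gap_of_le (hθ : Antitone θ) (hgap : θ ⟨m, hmK⟩ < θ ⟨m - 1, by omega⟩) {i : Fin K}
    (hi : m ≤ i) : gap θ m hm hmK i = θ ⟨m - 1, by omega⟩ - θ i :=
  if_neg (not_le.2 ((theta_le_of_le hmK hθ hi).trans_lt hgap))

theorem gap_pos (hθ : Antitone θ) (hgap : θ ⟨m, hmK⟩ < θ ⟨m - 1, by omega⟩) (i : Fin K) :
    0 < gap θ m hm hmK i := by
  rcases lt_or_ge (i : ℕ) m with hi | hi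
  · rw [gap_of_lt hm hmK hθ hi]
    linarith [le_theta_of_lt hm hmK hθ hi]
  · rw [gap_of_le hm hmK hθ hgap hi]
    linarith [theta_le_of_le hmK hθ hi]

include hmK in
/-- A set of `m` arms other than the top set contains an arm that is not a top arm, and misses a
top arm. -/
theorem exists_misplaced {H : Finset (Fin K)} (hH : H.card = m) (hne : H ≠ topSet K m) :
    (∃ g ∈ H, m ≤ (g : ℕ)) ∧ ∃ q ∉ H, (q : ℕ) < m := by
  constructor
  · by_contra! hcon
    exact hne (Finset.eq_of_subset_of_card_le (fun i hi => mem_topSet.2 (hcon i hi))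
      (by rw [card_topSet hmK.le, hH]))
  · by_contra! hcon
    refine hne (Finset.eq_of_subset_of_card_le (fun i hi => ?_)
      (by rw [card_topSet hmK.le, hH])).symm
    by_contra hiH
    exact absurd (hcon i hiH) (not_le.2 (mem_topSet.1 hi))

/-- If lower confidence bounds are valid for the other arms, and upper confidence bounds for the
top arms, then a set `H` that the confidence bounds separate from its complement is the top
set. -/
theorem eq_topSet_of_separated (hθ : Antitone θ)
    (hgap : θ ⟨m, hmK⟩ < θ ⟨m - 1, by omega⟩) {H : Finset (Fin K)} (hH : H.card = m)
    {lo up : Fin K → ℝ} (hlo : ∀ i : Fin K, m ≤ i → lo i ≤ θ i)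
    (hup : ∀ i : Fin K, (i : ℕ) < m → θ i ≤ up i)
    (hsep : ∀ i ∈ H, ∀ j ∉ H, up j ≤ lo i) : H = topSet K m := by
  by_contra hne
  obtain ⟨⟨g, hg, hgm⟩, q, hq, hqm⟩ := exists_misplaced hmK hH hne
  linarith [hsep g hg q hq, hlo g hgm, hup q hqm, theta_le_of_le hmK hθ hgm,
    le_theta_of_lt hm hmK hθ hqm]

/-- As long as the confidence bounds of the two critical arms `h` and `l` overlap, the gaps of both
are at most four times the larger one of their confidence radii. -/
theorem gap_le_of_overlap (hθ : Antitone θ) (hgap : θ ⟨m, hmK⟩ < θ ⟨m - 1, by omega⟩)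
    {H : Finset (Fin K)} (hH : H.card = m) {v lo up : Fin K → ℝ}
    (hv : ∀ i ∈ H, ∀ j ∉ H, v j ≤ v i)
    (hlo : ∀ i : Fin K, m ≤ i → lo i ≤ θ i) (hup : ∀ i : Fin K, (i : ℕ) < m → θ i ≤ up i)
    {h l : Fin K} (hh : h ∈ H) (hl : l ∉ H) (hmin : ∀ i ∈ H, lo h ≤ lo i)
    (hmax : ∀ i ∉ H, up i ≤ up l) (hover : lo h < up l) {w : ℝ} (hvh : |v h - θ h| ≤ w)
    (hvl : |v l - θ l| ≤ w) (hlh : v h - w ≤ lo h) (hul : up l ≤ v l + w) :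
    gap θ m hm hmK h ≤ 4 * w ∧ gap θ m hm hmK l ≤ 4 * w := by
  obtain ⟨hvh1, hvh2⟩ := abs_le.1 hvh
  obtain ⟨hvl1, hvl2⟩ := abs_le.1 hvl
  have hvv := hv h hh l hl
  by_cases hne : H = topSet K m
  · have hh' : (h : ℕ) < m := mem_topSet.1 (hne ▸ hh)
    have hl' : m ≤ (l : ℕ) := not_lt.1 fun hlt => hl (hne ▸ mem_topSet.2 hlt)
    rw [gap_of_lt hm hmK hθ hh', gap_of_le hm hmK hθ hgap hl']
    have h1 := le_theta_of_lt hm hmK hθ hh'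
    have h2 := theta_le_of_le hmK hθ hl'
    constructor <;> linarith
  · obtain ⟨⟨g, hg, hgm⟩, q, hq, hqm⟩ := exists_misplaced hmK hH hne
    have hloh : lo h ≤ θ ⟨m, hmK⟩ :=
      (hmin g hg).trans ((hlo g hgm).trans (theta_le_of_le hmK hθ hgm))
    have hupl : θ ⟨m - 1, by omega⟩ ≤ up l :=
      (le_theta_of_lt hm hmK hθ hqm).trans ((hup q hqm).trans (hmax q hq))
    constructor
    · rcases lt_or_ge (h : ℕ) m with hi | hi
      · rw [gap_of_lt hm hmK hθ hi]
        linarith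
      · rw [gap_of_le hm hmK hθ hgap hi]
        linarith
    · rcases lt_or_ge (l : ℕ) m with hi | hi
      · rw [gap_of_lt hm hmK hθ hi]
        linarith
      · rw [gap_of_le hm hmK hθ hgap hi]
        linarith

end Gaps

namespace TopM

variable {D K : ℕ} (A : TopM D K)

theorem high_spec (hmK : A.m ≤ K) (x : Fin K → ℕ → Pt D) (T : Fin K → ℕ) :
    (A.high x T).card = A.m ∧
      ∀ i ∈ A.high x T, ∀ j ∉ A.high x T, A.value x T j ≤ A.value x T i := by
  classical
  have h := A.tieSet.pick_mem ((Finset.powersetCard A.m Finset.univ).filter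
    (fun S => ∀ i ∈ S, ∀ j ∉ S, A.value x T j ≤ A.value x T i)) (by
      obtain ⟨S, hS, hv⟩ := exists_top_subset (A.value x T) hmK
      exact ⟨S, by simpa [hS] using hv⟩)
  rw [Finset.mem_filter, Finset.mem_powersetCard] at h
  convert! And.intro h.1.2 h.2 using 1

theorem hArm_spec (hm : 0 < A.m) (hmK : A.m ≤ K) (x : Fin K → ℕ → Pt D) (T : Fin K → ℕ) :
    A.hArm x T ∈ A.high x T ∧ ∀ j ∈ A.high x T, A.lcb x T (A.hArm x T) ≤ A.lcb x T j := by
  classical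
  have h := A.tieArm.pick_mem ((A.high x T).filter
    (fun i => ∀ j ∈ A.high x T, A.lcb x T i ≤ A.lcb x T j)) (by
      obtain ⟨i, hi, hmin⟩ := (A.high x T).exists_min_image (A.lcb x T)
        (Finset.card_pos.1 (by rw [(A.high_spec hmK x T).1]; exact hm))
      exact ⟨i, by simpa [hi] using hmin⟩)
  rw [Finset.mem_filter] at h
  convert! h using 1

theorem lArm_spec (hmK : A.m < K) (x : Fin K → ℕ → Pt D) (T : Fin K → ℕ) :
    A.lArm x T ∉ A.high x T ∧ ∀ j ∉ A.high x T, A.ucb x T j ≤ A.ucb x T (A.lArm x T) := by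
  classical
  have h := A.tieArm.pick_mem ((A.high x T)ᶜ.filter
    (fun i => ∀ j ∈ (A.high x T)ᶜ, A.ucb x T j ≤ A.ucb x T i)) (by
      obtain ⟨i, hi, hmax⟩ := (A.high x T)ᶜ.exists_max_image (A.ucb x T)
        (Finset.card_pos.1 (by
          rw [Finset.card_compl, (A.high_spec hmK.le x T).1, Fintype.card_fin]
          omega))
      exact ⟨i, by simpa using ⟨by simpa using hi, by simpa using hmax⟩⟩)
  rw [Finset.mem_filter, Finset.mem_compl] at h
  convert! And.intro h.1 fun j hj => h.2 j (Finset.mem_compl.2 hj) using 1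

/-- The confidence parameter of the bound that has to be valid for arm `i`: the upper one for the
top arms, the lower one for the others. These parameters add up to `δ`. -/
noncomputable def level (i : Fin K) : ℝ :=
  if (i : ℕ) < A.m then A.δ / (2 * A.m) else A.δ / (2 * ((K : ℝ) - A.m))

/-- The event that, for all sample sizes from `N₀` on, the estimated score of each arm is within the
confidence radius of its level. -/
def Good (θ : Fin K → ℝ) (x : Fin K → ℕ → Pt D) : Prop :=
  ∀ i, ∀ t ≥ A.N₀, |A.score (empMode A.tieSample t (x i)) - θ i| ≤
    confRadius D A.N₀ t (A.level i)

/-- An upper bound for all confidence radii in use, where `Λ = 1 + log (2K/δ)`. Unlike the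
confidence radius, it is evidently decreasing in `t`, from `exp (2(4+D))` on. -/
noncomputable def width (D : ℕ) (Λ : ℝ) (t : ℕ) : ℝ :=
  (2 * Real.log t + Λ) * (Real.log t / (t : ℝ) ^ ((1 : ℝ) / (4 + D)))

theorem confRadius_le_width {N₀ t : ℕ} (hN : 1 ≤ N₀) (ht : N₀ ≤ t) {δ d : ℝ} (hδ : 0 < δ)
    (hK : 0 < K) (hd : δ / (2 * K) ≤ d) :
    confRadius D N₀ t d ≤ width D (1 + Real.log (2 * K / δ)) t := by
  have hK' : (0 : ℝ) < K := by exact_mod_cast hK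
  refine (confRadius_anti (hN.trans ht) (by positivity) hd).trans ?_
  refine (confRadius_le hN ht _).trans (le_of_eq ?_)
  rw [width, one_div_div]

theorem width_anti {Λ : ℝ} (hΛ : 0 ≤ Λ) {s t : ℕ} (hs : Real.exp (2 * (4 + D)) ≤ s)
    (hst : s ≤ t) : width D Λ t ≤ width D Λ s := by
  have hst' : (s : ℝ) ≤ t := by exact_mod_cast hst
  have hs0 : (0 : ℝ) < s := (Real.exp_pos _).trans_le hs
  have ht0 : (0 : ℝ) < t := hs0.trans_le hst'
  have h1s : (1 : ℝ) ≤ s := (Real.one_le_exp (by positivity)).trans hs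
  set α : ℝ := 1 / (4 + D) with hα
  have hα0 : 0 < α := by positivity
  have hexp : ∀ c ≥ α / 2, ∀ u : ℝ, Real.exp (2 * (4 + D)) ≤ u →
      u ∈ Set.Ici (Real.exp c⁻¹) := by
    intro c hc u hu
    refine le_trans (Real.exp_le_exp.2 ?_) hu
    rw [← one_div, div_le_iff₀ (by linarith)]
    have : (2 * (4 + D) : ℝ) * (α / 2) = 1 := by
      rw [hα]
      field_simp
    rw [← this]
    gcongr
  have key : ∀ c ≥ α / 2, Real.log t / (t : ℝ) ^ c ≤ Real.log s / (s : ℝ) ^ c := fun c hc =>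
    Real.log_div_self_rpow_antitoneOn (by linarith) (hexp c hc s hs)
      (hexp c hc t (hs.trans hst')) hst'
  have hsplit : ∀ u : ℝ, 0 < u → (2 * Real.log u + Λ) * (Real.log u / u ^ α) =
      2 * (Real.log u / u ^ (α / 2)) ^ 2 + Λ * (Real.log u / u ^ α) := by
    intro u hu
    have : u ^ α = (u ^ (α / 2)) ^ 2 := by
      rw [← Real.rpow_natCast, ← Real.rpow_mul hu.le]
      norm_num
    rw [this]
    field_simp
  have hlogt : 0 ≤ Real.log t := Real.log_nonneg (h1s.trans hst')
  rw [width, width, hsplit t ht0, hsplit s hs0]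
  have h1 := key (α / 2) le_rfl
  have h2 := key α (by linarith)
  gcongr

variable {A} {θ : Fin K → ℝ} {x : Fin K → ℕ → Pt D} {T : Fin K → ℕ}

theorem Good.lcb_le (hg : A.Good θ x) (hT : ∀ i, A.N₀ ≤ T i) (i : Fin K) (hi : A.m ≤ i) :
    A.lcb x T i ≤ θ i := by
  have h := hg i (T i) (hT i)
  rw [level, if_neg (not_lt.2 hi)] at h
  rw [lcb, value]
  linarith [(abs_le.1 h).2]

theorem Good.le_ucb (hg : A.Good θ x) (hT : ∀ i, A.N₀ ≤ T i) (i : Fin K) (hi : (i : ℕ) < A.m) :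
    θ i ≤ A.ucb x T i := by
  have h := hg i (T i) (hT i)
  rw [level, if_pos hi] at h
  rw [ucb, value]
  linarith [(abs_le.1 h).1]

theorem Good.high_eq (hm : 0 < A.m) (hmK : A.m < K) (hg : A.Good θ x) (hT : ∀ i, A.N₀ ≤ T i)
    (hθ : Antitone θ) (hgap : θ ⟨A.m, hmK⟩ < θ ⟨A.m - 1, (Nat.sub_le _ _).trans_lt hmK⟩)
    (hst : A.Stops x T) :
    A.high x T = topSet K A.m :=
  eq_topSet_of_separated hm hmK hθ hgap (A.high_spec hmK.le x T).1 (hg.lcb_le hT) (hg.le_ucb hT)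
    fun i hi j hj => ((A.lArm_spec hmK x T).2 j hj).trans
      (hst.trans ((A.hArm_spec hm hmK.le x T).2 i hi))

theorem le_level (hm : 0 < A.m) (hmK : A.m < K) (hδ : 0 < A.δ) (i : Fin K) :
    A.δ / (2 * K) ≤ A.level i := by
  have h1 : (0 : ℝ) < A.m := by exact_mod_cast hm
  have h2 : (A.m : ℝ) < K := by exact_mod_cast hmK
  rw [level]
  split_ifs
  · gcongr
  · have : 0 < (K : ℝ) - A.m := by linarith
    gcongr
    linarith

/-- The arm among the two critical ones that was pulled less often. -/
noncomputable def rareArm (A : TopM D K) (x : Fin K → ℕ → Pt D) (T : Fin K → ℕ) : Fin K :=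
  if T (A.hArm x T) ≤ T (A.lArm x T) then A.hArm x T else A.lArm x T

/-- Before the algorithm stops, the confidence radius of the less often pulled critical arm is still
comparable to its gap. -/
theorem Good.gap_rareArm_le (hm : 0 < A.m) (hmK : A.m < K) (hδ : 0 < A.δ) (hδ1 : A.δ < 1)
    (hN : Real.exp (2 * (4 + D)) ≤ A.N₀)
    (hg : A.Good θ x) (hT : ∀ i, A.N₀ ≤ T i) (hθ : Antitone θ)
    (hgap : θ ⟨A.m, hmK⟩ < θ ⟨A.m - 1, (Nat.sub_le _ _).trans_lt hmK⟩) (hst : ¬ A.Stops x T) :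
    gap θ A.m hm hmK (A.rareArm x T) ≤
      4 * width D (1 + Real.log (2 * K / A.δ)) (T (A.rareArm x T)) := by
  have hK : 0 < K := by omega
  have hK1 : (1 : ℝ) ≤ K := by exact_mod_cast hK
  have h1 : (0 : ℝ) < A.m := by exact_mod_cast hm
  have h2 : (A.m : ℝ) < K := by exact_mod_cast hmK
  have h3 : 0 < (K : ℝ) - A.m := by linarith
  have hN1 : 1 ≤ A.N₀ := by
    have : (1 : ℝ) ≤ A.N₀ := (Real.one_le_exp (by positivity)).trans hN
    exact_mod_cast this
  have hΛ : 0 ≤ 1 + Real.log (2 * K / A.δ) := by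
    have : 0 ≤ Real.log (2 * K / A.δ) := Real.log_nonneg (by rw [le_div_iff₀ hδ]; linarith)
    linarith
  set W := width D (1 + Real.log (2 * K / A.δ)) with hW
  have hWT : ∀ i {d}, A.δ / (2 * K) ≤ d → confRadius D A.N₀ (T i) d ≤ W (T i) :=
    fun i d hd => confRadius_le_width hN1 (hT i) hδ hK hd
  set h := A.hArm x T with hh
  set l := A.lArm x T with hl
  obtain ⟨hh1, hh2⟩ := A.hArm_spec hm hmK.le x T
  obtain ⟨hl1, hl2⟩ := A.lArm_spec hmK x T
  have key : ∀ w, W (T h) ≤ w → W (T l) ≤ w →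
      gap θ A.m hm hmK h ≤ 4 * w ∧ gap θ A.m hm hmK l ≤ 4 * w := by
    intro w hwh hwl
    refine gap_le_of_overlap hm hmK hθ hgap (A.high_spec hmK.le x T).1 (v := A.value x T)
      (A.high_spec hmK.le x T).2 (hg.lcb_le hT) (hg.le_ucb hT) hh1 hl1 hh2 hl2 (not_le.1 hst)
      ?_ ?_ ?_ ?_
    · exact (hg h (T h) (hT h)).trans ((hWT h (le_level hm hmK hδ h)).trans hwh)
    · exact (hg l (T l) (hT l)).trans ((hWT l (le_level hm hmK hδ l)).trans hwl)
    · have := (hWT h (d := A.δ / (2 * ((K : ℝ) - A.m))) (by gcongr; linarith)).trans hwh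
      rw [lcb]
      linarith
    · have := (hWT l (d := A.δ / (2 * (A.m : ℝ))) (by gcongr)).trans hwl
      rw [ucb]
      linarith
  have hNT : ∀ i, Real.exp (2 * (4 + D)) ≤ T i := fun i =>
    hN.trans (by exact_mod_cast hT i)
  rw [rareArm]
  split_ifs with hc
  · exact (key _ le_rfl (width_anti hΛ (hNT h) hc)).1
  · exact (key _ (width_anti hΛ (hNT l) (not_le.1 hc).le) le_rfl).2

end TopM

/-! ### Favourable rounds, and measurability of the algorithm -/

namespace TopM

variable {D K : ℕ} (A : TopM D K)

theorem le_counts (x : Fin K → ℕ → Pt D) (u : ℕ → ℝ) (j : ℕ) (i : Fin K) :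
    A.N₀ ≤ A.counts x u j i := by
  induction j with
  | zero => exact le_rfl
  | succ j ih =>
    refine ih.trans ?_
    rw [counts, step]
    split_ifs
    · exact le_rfl
    · rw [Function.update_apply]
      split_ifs with h
      · rw [h]
        exact Nat.le_succ _
      · exact le_rfl

/-- The condition that the critical arm `h` has been pulled at most as often as `l`. -/
def HRare (x : Fin K → ℕ → Pt D) (T : Fin K → ℕ) : Prop := T (A.hArm x T) ≤ T (A.lArm x T)

/-- The coin of round `j` shows the half of `[0, 1]` for which the less often pulled critical arm is
certain to be pulled. -/
def Favourable (x : Fin K → ℕ → Pt D) (u : ℕ → ℝ) (j : ℕ) : Prop :=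
  u j < 1 / 2 ↔ A.HRare x (A.counts x u j)

variable {A} {x : Fin K → ℕ → Pt D} {u : ℕ → ℝ}

theorem nextArm_eq_rareArm (hN : 1 ≤ A.N₀) {j : ℕ} (hf : A.Favourable x u j) :
    A.nextArm x (A.counts x u j) (u j) = A.rareArm x (A.counts x u j) := by
  have hT := A.le_counts x u j
  set T := A.counts x u j with hTdef
  have h1 : (1 : ℝ) ≤ T (A.hArm x T) := by exact_mod_cast hN.trans (hT _)
  have h2 : (1 : ℝ) ≤ T (A.lArm x T) := by exact_mod_cast hN.trans (hT _)
  rw [Favourable, ← hTdef, HRare] at hf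
  rw [nextArm, rareArm]
  by_cases hc : T (A.hArm x T) ≤ T (A.lArm x T)
  · have hc' : (T (A.hArm x T) : ℝ) ≤ T (A.lArm x T) := by exact_mod_cast hc
    rw [if_pos hc, if_pos]
    refine (hf.2 hc).trans_le ?_
    rw [div_le_div_iff₀ two_pos (by linarith)]
    linarith
  · have hc' : (T (A.lArm x T) : ℝ) ≤ T (A.hArm x T) := by exact_mod_cast (not_le.1 hc).le
    rw [if_neg hc, if_neg]
    refine not_lt.2 (le_trans ?_ (not_lt.1 fun h => hc (hf.1 h)))
    rw [div_le_div_iff₀ (by linarith) two_pos]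
    linarith

open Classical in
/-- While the algorithm runs, each favourable round adds a pull to an arm below its budget `b`, so
that the number of favourable rounds is at most the total of the pulls within budget. -/
theorem card_favourable_le (hN : 1 ≤ A.N₀) {b : Fin K → ℝ} (hb : ∀ i, 0 ≤ b i)
    (hneed : ∀ T : Fin K → ℕ, (∀ i, A.N₀ ≤ T i) → ¬ A.Stops x T →
      (T (A.rareArm x T) : ℝ) ≤ b (A.rareArm x T)) (J : ℕ)
    (hrun : ∀ j < J, ¬ A.Stops x (A.counts x u j)) :
    (((Finset.range J).filter fun j => A.Favourable x u j).card : ℝ) ≤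
      ∑ i, min ((A.counts x u J i : ℝ) - A.N₀) (b i) := by
  have hN' : (1 : ℝ) ≤ A.N₀ := by exact_mod_cast hN
  induction J with
  | zero =>
    refine le_of_eq_of_le (by simp) (Finset.sum_nonneg fun i _ => le_min ?_ (hb i))
    simp [counts]
  | succ J ih =>
    have ih := ih fun j hj => hrun j (by omega)
    have hT := A.le_counts x u J
    have hns := hrun J (by omega)
    have hcounts : A.counts x u (J + 1) = Function.update (A.counts x u J)
        (A.nextArm x (A.counts x u J) (u J))
        (A.counts x u J (A.nextArm x (A.counts x u J) (u J)) + 1) := by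
      rw [counts, step, if_neg hns]
    have hmono : ∀ i, min ((A.counts x u J i : ℝ) - A.N₀) (b i) ≤
        min ((A.counts x u (J + 1) i : ℝ) - A.N₀) (b i) := by
      intro i
      have : A.counts x u J i ≤ A.counts x u (J + 1) i := by
        rw [hcounts, Function.update_apply]
        split_ifs with h
        · rw [h]
          exact Nat.le_succ _
        · exact le_rfl
      gcongr
    rw [Finset.range_add_one, Finset.filter_insert]
    split_ifs with hf
    · rw [Finset.card_insert_of_notMem (by simp)]
      set a := A.rareArm x (A.counts x u J) with ha
      have hinc : min ((A.counts x u J a : ℝ) - A.N₀) (b a) + 1 ≤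
          min ((A.counts x u (J + 1) a : ℝ) - A.N₀) (b a) := by
        have h1 := hneed _ hT hns
        rw [← ha] at h1
        have h2 : A.counts x u (J + 1) a = A.counts x u J a + 1 := by
          rw [hcounts, nextArm_eq_rareArm hN hf, ← ha, Function.update_self]
        rw [h2]
        push_cast
        rw [min_eq_left (by linarith), min_eq_left (by linarith)]
        linarith
      rw [← Finset.add_sum_erase _ _ (Finset.mem_univ a)] at ih ⊢
      have h3 := Finset.sum_le_sum fun i (_ : i ∈ Finset.univ.erase a) => hmono i
      push_cast
      linarith
    · exact ih.trans (Finset.sum_le_sum fun i _ => hmono i)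

end TopM

section Measurability

variable {Ω : Type*} [MeasurableSpace Ω] {D : ℕ}

/-- A random element of a countable set, inserted into a family of random variables. -/
theorem measurable_eval_countable {α β : Type*} [MeasurableSpace α] [Countable α]
    [MeasurableSingletonClass α] [MeasurableSpace β] {F : α → Ω → β} (hF : ∀ a, Measurable (F a))
    {g : Ω → α} (hg : Measurable g) : Measurable fun ω => F (g ω) ω :=
  (measurable_from_prod_countable_right (f := fun p : α × Ω => F p.1 p.2) hF).comp
    (hg.prodMk measurable_id)

/-- A random finite set is measurable if its membership events are. -/
theorem measurable_comp_finset {α β : Type*} [Countable α] [MeasurableSpace β] {F : Ω → Finset α}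
    (hF : ∀ a, Measurable fun ω => a ∈ F ω) (g : Finset α → β) : Measurable fun ω => g (F ω) := by
  let _ : MeasurableSpace (Finset α) := ⊤
  have hm : Measurable F := by
    refine measurable_to_countable' fun S => ?_
    have : F ⁻¹' {S} = {ω | ∀ a, a ∈ F ω ↔ a ∈ S} := by
      ext ω
      simp [Finset.ext_iff]
    rw [this, measurableSet_setOfPred]
    exact Measurable.forall fun a => (hF a).iff measurable_const
  exact (measurable_from_top : Measurable g).comp hm

theorem measurable_le_prop {f g : Ω → ℝ} (hf : Measurable f) (hg : Measurable g) :
    Measurable fun ω => f ω ≤ g ω :=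
  measurableSet_setOfPred.1 (measurableSet_le hf hg)

variable {X : ℕ → Ω → Pt D}

theorem measurable_knnRadius (hX : ∀ i, Measurable (X i)) {k : ℝ} {n : ℕ} (hk : k ≤ n) (j : ℕ) :
    Measurable fun ω => knnRadius k n (fun s => X s ω) (X j ω) := by
  refine measurable_of_Iic fun ρ => ?_
  rcases lt_or_ge ρ 0 with hρ | hρ
  · convert MeasurableSet.empty
    ext ω
    have : 0 ≤ knnRadius k n (fun s => X s ω) (X j ω) := Real.sInf_nonneg fun _ h => h.1
    simp only [Set.mem_preimage, Set.mem_Iic, Set.mem_empty_iff_false, iff_false, not_le]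
    linarith
  · have : (fun ω => knnRadius k n (fun s => X s ω) (X j ω)) ⁻¹' Set.Iic ρ =
        {ω | k ≤ ∑ i ∈ Finset.range n, if dist (X i ω) (X j ω) ≤ ρ then (1 : ℝ) else 0} := by
      ext ω
      simp only [Set.mem_preimage, Set.mem_Iic, knnRadius_le_iff hk hρ, Set.mem_ofPred_eq,
        Finset.sum_boole]
    rw [this]
    refine measurableSet_le measurable_const (Finset.measurable_sum _ fun i _ => ?_)
    exact Measurable.ite (measurableSet_le ((hX i).dist (hX j)) measurable_const)
      measurable_const measurable_const

theorem measurable_empMode (hX : ∀ i, Measurable (X i)) (σ : TieBreak ℕ) (n : ℕ) :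
    Measurable fun ω => empMode σ n fun s => X s ω := by
  refine measurable_eval_countable (F := X) hX
    (measurable_comp_finset (F := fun ω => modeCandidates n fun s => X s ω) (fun j => ?_) σ.pick)
  rcases Nat.eq_zero_or_pos n with rfl | hn
  · simp [modeCandidates]
  have hr := fun j => measurable_knnRadius hX (rpow_four_div_le (D := D) hn) j
  simp only [modeCandidates, Finset.mem_filter]
  exact measurable_const.and (Measurable.forall fun j' => measurable_const.imp
    (measurable_le_prop (hr j) (hr j')))

end Measurability

namespace TopM

variable {D K : ℕ} (A : TopM D K) {Ω : Type*} [MeasurableSpace Ω] {X : Fin K → ℕ → Ω → Pt D}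

section FixedCounts

variable (hA : Measurable A.score) (hX : ∀ i s, Measurable (X i s)) (T : Fin K → ℕ)

include hA hX

theorem measurable_value (i : Fin K) : Measurable fun ω => A.value (fun i s => X i s ω) T i :=
  hA.comp (measurable_empMode (hX i) A.tieSample (T i))

theorem measurable_mem_high (i : Fin K) :
    Measurable fun ω => i ∈ A.high (fun i s => X i s ω) T := by
  classical
  refine measurable_comp_finset (α := Finset (Fin K)) (fun S => ?_) fun F => i ∈ A.tieSet.pick F
  simp only [Finset.mem_filter]
  exact measurable_const.and (Measurable.forall fun i => measurable_const.imp
    (Measurable.forall fun j => measurable_const.imp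
      (measurable_le_prop (A.measurable_value hA hX T j) (A.measurable_value hA hX T i))))

theorem measurable_lcb (i : Fin K) : Measurable fun ω => A.lcb (fun i s => X i s ω) T i :=
  (A.measurable_value hA hX T i).sub_const _

theorem measurable_ucb (i : Fin K) : Measurable fun ω => A.ucb (fun i s => X i s ω) T i :=
  (A.measurable_value hA hX T i).add_const _

theorem measurable_hArm : Measurable fun ω => A.hArm (fun i s => X i s ω) T := by
  classical
  refine measurable_comp_finset (fun i => ?_) A.tieArm.pick
  simp only [Finset.mem_filter]
  exact (A.measurable_mem_high hA hX T i).and (Measurable.forall fun j =>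
    (A.measurable_mem_high hA hX T j).imp
      (measurable_le_prop (A.measurable_lcb hA hX T i) (A.measurable_lcb hA hX T j)))

theorem measurable_lArm : Measurable fun ω => A.lArm (fun i s => X i s ω) T := by
  classical
  refine measurable_comp_finset (fun i => ?_) A.tieArm.pick
  simp only [Finset.mem_filter, Finset.mem_compl]
  exact (A.measurable_mem_high hA hX T i).not.and (Measurable.forall fun j =>
    (A.measurable_mem_high hA hX T j).not.imp
      (measurable_le_prop (A.measurable_ucb hA hX T j) (A.measurable_ucb hA hX T i)))

theorem measurable_stops : Measurable fun ω => A.Stops (fun i s => X i s ω) T :=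
  measurable_le_prop
    (measurable_eval_countable (A.measurable_ucb hA hX T) (A.measurable_lArm hA hX T))
    (measurable_eval_countable (A.measurable_lcb hA hX T) (A.measurable_hArm hA hX T))

theorem measurable_hRare : Measurable fun ω => A.HRare (fun i s => X i s ω) T :=
  (Measurable.of_discrete (f := fun p : Fin K × Fin K => T p.1 ≤ T p.2)).comp
    ((A.measurable_hArm hA hX T).prodMk (A.measurable_lArm hA hX T))

theorem measurable_nextArm {V : Ω → ℝ} (hV : Measurable V) :
    Measurable fun ω => A.nextArm (fun i s => X i s ω) T (V ω) := by
  classical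
  have hh := A.measurable_hArm hA hX T
  have hl := A.measurable_lArm hA hX T
  refine Measurable.ite (measurableSet_lt hV ?_) hh hl
  exact (Measurable.of_discrete (f := fun p : Fin K × Fin K =>
    (T p.2 : ℝ) / ((T p.1 : ℝ) + (T p.2 : ℝ)))).comp (hh.prodMk hl)

theorem measurable_step {V : Ω → ℝ} (hV : Measurable V) :
    Measurable fun ω => A.step (fun i s => X i s ω) T (V ω) := by
  classical
  refine Measurable.ite (measurableSet_setOfPred.2 (A.measurable_stops hA hX T))
    measurable_const ?_
  exact (Measurable.of_discrete (f := fun i => Function.update T i (T i + 1))).comp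
    (A.measurable_nextArm hA hX T hV)

end FixedCounts

/-- The numbers of pulls after `j` rounds depend measurably on the rewards and on the coins of these
rounds. -/
theorem measurable_counts (hA : Measurable A.score) (hX : ∀ i s, Measurable (X i s))
    {U : ℕ → Ω → ℝ} (j : ℕ) (hU : ∀ i < j, Measurable (U i)) :
    Measurable fun ω => A.counts (fun i s => X i s ω) (fun i => U i ω) j := by
  induction j with
  | zero => exact measurable_const
  | succ j ih =>
    exact measurable_eval_countable
      (fun T => A.measurable_step hA hX T (hU j (Nat.lt_succ_self j)))
      (ih fun i hi => hU i (hi.trans (Nat.lt_succ_self j)))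

theorem measurable_hRare_counts (hA : Measurable A.score) (hX : ∀ i s, Measurable (X i s))
    {U : ℕ → Ω → ℝ} (j : ℕ) (hU : ∀ i < j, Measurable (U i)) :
    Measurable fun ω => A.HRare (fun i s => X i s ω)
      (A.counts (fun i s => X i s ω) (fun i => U i ω) j) :=
  measurable_eval_countable (fun T => A.measurable_hRare hA hX T) (A.measurable_counts hA hX j hU)

end TopM

/-! ### Fair coins -/

section Coins

variable {Ω : Type*} [mΩ : MeasurableSpace Ω] {P : Measure Ω}

/-- The expectation of a function of a uniform coin that is constant on each half of `[0, 1]`. -/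
theorem lintegral_ite_lt_half {V : Ω → ℝ} (hV : Measurable V)
    (hlaw : P.map V = volume.restrict (Set.Icc (0 : ℝ) 1)) (r s : ENNReal) :
    ∫⁻ ω, (if V ω < 1 / 2 then r else s) ∂P = (r + s) / 2 := by
  have hm : Measurable fun v : ℝ => if v < 1 / 2 then r else s :=
    Measurable.ite measurableSet_Iio measurable_const measurable_const
  rw [← lintegral_map (f := fun v : ℝ => if v < 1 / 2 then r else s) hm hV, hlaw]
  have h1 : (fun v : ℝ => if v < 1 / 2 then r else s) =
      fun v => (Set.Iio (1 / 2 : ℝ)).indicator (fun _ => r) v +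
        (Set.Ici (1 / 2 : ℝ)).indicator (fun _ => s) v := by
    ext v
    by_cases h : v < 1 / 2
    · simp [-one_div, h, not_le.2 h]
    · simp [-one_div, h, not_lt.1 h]
  rw [h1, lintegral_add_left (measurable_const.indicator measurableSet_Iio),
    lintegral_indicator_const measurableSet_Iio, lintegral_indicator_const measurableSet_Ici,
    Measure.restrict_apply measurableSet_Iio, Measure.restrict_apply measurableSet_Ici]
  have h2 : Set.Iio (1 / 2 : ℝ) ∩ Set.Icc 0 1 = Set.Ico 0 (1 / 2) := by
    ext v
    simp only [Set.mem_inter_iff, Set.mem_Iio, Set.mem_Icc, Set.mem_Ico]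
    constructor
    · rintro ⟨h, h', -⟩
      exact ⟨h', h⟩
    · rintro ⟨h, h'⟩
      exact ⟨h', h, by linarith⟩
  have h3 : Set.Ici (1 / 2 : ℝ) ∩ Set.Icc 0 1 = Set.Icc (1 / 2) 1 := by
    ext v
    simp only [Set.mem_inter_iff, Set.mem_Ici, Set.mem_Icc]
    constructor
    · rintro ⟨h, -, h'⟩
      exact ⟨h, h'⟩
    · rintro ⟨h, h'⟩
      exact ⟨h, by linarith, h'⟩
  have h4 : ENNReal.ofReal (1 / 2) = 2⁻¹ := by
    rw [one_div, ENNReal.ofReal_inv_of_pos two_pos, ENNReal.ofReal_ofNat]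
  rw [h2, h3, Real.volume_Ico, Real.volume_Icc, sub_zero, show (1 : ℝ) - 1 / 2 = 1 / 2 by norm_num,
    h4, ← add_mul, div_eq_mul_inv]

open Classical in
theorem measurable_prod_guess {Ω : Type*} [MeasurableSpace Ω] {V : ℕ → Ω → ℝ} {a : ℕ → Ω → Prop}
    {J : ℕ} (hV : ∀ i < J, Measurable (V i)) (ha : ∀ i < J, Measurable (a i)) (r : ENNReal) :
    Measurable fun ω =>
      ∏ i ∈ Finset.range J, (if (V i ω < 1 / 2 ↔ a i ω) then r else 1) := by
  refine Finset.measurable_prod _ fun i hi => ?_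
  have hi' := Finset.mem_range.1 hi
  refine Measurable.ite (measurableSet_setOfPred.2 (Measurable.iff ?_ (ha i hi')))
    measurable_const measurable_const
  exact measurableSet_setOfPred.1 (hV i hi' measurableSet_Iio)

variable [IsProbabilityMeasure P] {ℱ : ℕ → MeasurableSpace Ω} {V : ℕ → Ω → ℝ} {a : ℕ → Ω → Prop}

open Classical in
/-- Guesses of fair coins that only use the past are right independently with probability `1/2`:
the generating function of the number of right guesses is that of a binomial variable. -/
theorem lintegral_prod_guess (hle : ∀ j, ℱ j ≤ mΩ) (hV : ∀ i, Measurable (V i))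
    (hVℱ : ∀ j, ∀ i < j, Measurable[ℱ j] (V i)) (ha : ∀ j, ∀ i ≤ j, Measurable[ℱ j] (a i))
    (hind : ∀ j, Indep (ℱ j) (MeasurableSpace.comap (V j) inferInstance) P)
    (hlaw : ∀ j, P.map (V j) = volume.restrict (Set.Icc (0 : ℝ) 1)) (r : ENNReal) (J : ℕ) :
    ∫⁻ ω, ∏ i ∈ Finset.range J, (if (V i ω < 1 / 2 ↔ a i ω) then r else 1) ∂P =
      ((r + 1) / 2) ^ J := by
  induction J with
  | zero => simp
  | succ J ih =>
    set F : Ω → ENNReal := fun ω =>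
      ∏ i ∈ Finset.range J, (if (V i ω < 1 / 2 ↔ a i ω) then r else 1) with hF
    have hFm : Measurable[ℱ J] F :=
      @measurable_prod_guess _ (ℱ J) _ _ J (hVℱ J) (fun i hi => ha J i hi.le) r
    have haS : MeasurableSet[ℱ J] {ω | a J ω} :=
      (@measurableSet_setOfPred _ (ℱ J) _).2 (ha J J le_rfl)
    have hcoin : ∀ r s : ENNReal, Measurable[MeasurableSpace.comap (V J) inferInstance]
        fun ω => if V J ω < 1 / 2 then r else s := fun r s =>
      (Measurable.ite measurableSet_Iio measurable_const measurable_const :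
        Measurable fun v : ℝ => if v < 1 / 2 then r else s).comp
        (@comap_measurable _ _ _ (V J))
    have key : ∀ (S : Set Ω), MeasurableSet[ℱ J] S → ∀ r s : ENNReal,
        ∫⁻ ω, S.indicator F ω * (if V J ω < 1 / 2 then r else s) ∂P =
          (∫⁻ ω, S.indicator F ω ∂P) * ((r + s) / 2) := by
      intro S hS r s
      rw [lintegral_mul_eq_lintegral_mul_lintegral_of_independent_measurableSpace (hle J)
        (hV J).comap_le (hind J) (hFm.indicator hS) (hcoin r s),
        lintegral_ite_lt_half (hV J) (hlaw J)]
    have hsplit : ∀ ω, ∏ i ∈ Finset.range (J + 1), (if (V i ω < 1 / 2 ↔ a i ω) then r else 1) =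
        {ω | a J ω}.indicator F ω * (if V J ω < 1 / 2 then r else 1) +
          {ω | a J ω}ᶜ.indicator F ω * (if V J ω < 1 / 2 then 1 else r) := by
      intro ω
      rw [Finset.prod_range_succ]
      change F ω * _ = _
      by_cases h1 : a J ω <;> by_cases h2 : V J ω < 1 / 2 <;> simp [-one_div, h1, h2]
    have hmeas : Measurable fun ω =>
        {ω | a J ω}.indicator F ω * (if V J ω < 1 / 2 then r else 1) :=
      ((hFm.mono (hle J) le_rfl).indicator (hle J _ haS)).mul
        ((hcoin r 1).mono (hV J).comap_le le_rfl)
    rw [lintegral_congr hsplit, lintegral_add_left hmeas, key _ haS, key _ haS.compl,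
      add_comm 1 r, ← add_mul, ← lintegral_add_left
        ((hFm.mono (hle J) le_rfl).indicator (hle J _ haS)), pow_succ, ← ih]
    congr 2
    exact Set.indicator_self_add_compl {ω | a J ω} F

open Classical in
/-- Few right guesses among `J` are exponentially unlikely. -/
theorem measure_card_guess_le (hle : ∀ j, ℱ j ≤ mΩ) (hV : ∀ i, Measurable (V i))
    (hVℱ : ∀ j, ∀ i < j, Measurable[ℱ j] (V i)) (ha : ∀ j, ∀ i ≤ j, Measurable[ℱ j] (a i))
    (hind : ∀ j, Indep (ℱ j) (MeasurableSpace.comap (V j) inferInstance) P)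
    (hlaw : ∀ j, P.map (V j) = volume.restrict (Set.Icc (0 : ℝ) 1)) (J : ℕ) (b : ℝ) :
    P {ω | (((Finset.range J).filter fun i => V i ω < 1 / 2 ↔ a i ω).card : ℝ) ≤ b} ≤
      ENNReal.ofReal (Real.exp (b - J / 4)) := by
  set r : ENNReal := ENNReal.ofReal (Real.exp (-1)) with hr
  have hint := lintegral_prod_guess hle hV hVℱ ha hind hlaw r J
  have hprod : ∀ ω, ∏ i ∈ Finset.range J, (if (V i ω < 1 / 2 ↔ a i ω) then r else 1) =
      ENNReal.ofReal (Real.exp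
        (-(((Finset.range J).filter fun i => V i ω < 1 / 2 ↔ a i ω).card : ℝ))) := by
    intro ω
    rw [Finset.prod_ite, Finset.prod_const, Finset.prod_const_one, mul_one, hr,
      ← ENNReal.ofReal_pow (Real.exp_pos _).le, ← Real.exp_nat_mul]
    simp
  have hq : (r + 1) / 2 ≤ ENNReal.ofReal (Real.exp (-(1 / 4))) := by
    rw [hr, ← ENNReal.ofReal_one, ← ENNReal.ofReal_add (Real.exp_pos _).le zero_le_one,
      ← ENNReal.ofReal_ofNat 2, ← ENNReal.ofReal_div_of_pos two_pos]
    refine ENNReal.ofReal_le_ofReal ?_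
    have h1 := Real.exp_neg_one_lt_d9
    have h2 := Real.add_one_le_exp (-(1 / 4) : ℝ)
    linarith
  have hb : ENNReal.ofReal (Real.exp (-b)) ≠ 0 := by simp [Real.exp_pos]
  have hmarkov := meas_le_lintegral₀ (μ := P) (s := {ω | (((Finset.range J).filter
    fun i => V i ω < 1 / 2 ↔ a i ω).card : ℝ) ≤ b})
    (f := fun ω => ENNReal.ofReal (Real.exp b) *
      ∏ i ∈ Finset.range J, (if (V i ω < 1 / 2 ↔ a i ω) then r else 1))
  have hFm := measurable_prod_guess (J := J) (fun i _ => hV i)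
    (fun i _ => (ha i i le_rfl).mono (hle i) le_rfl) r
  calc _ ≤ ∫⁻ ω, ENNReal.ofReal (Real.exp b) *
        ∏ i ∈ Finset.range J, (if (V i ω < 1 / 2 ↔ a i ω) then r else 1) ∂P := by
        refine hmarkov (hFm.const_mul _).aemeasurable fun ω hω => ?_
        rw [hprod, ← ENNReal.ofReal_mul (Real.exp_pos _).le, ← Real.exp_add,
          ← ENNReal.ofReal_one]
        refine ENNReal.ofReal_le_ofReal (Real.one_le_exp ?_)
        have : (((Finset.range J).filter fun i => V i ω < 1 / 2 ↔ a i ω).card : ℝ) ≤ b := hω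
        linarith
    _ = ENNReal.ofReal (Real.exp b) * ((r + 1) / 2) ^ J := by
        rw [lintegral_const_mul _ hFm, hint]
    _ ≤ ENNReal.ofReal (Real.exp b) * ENNReal.ofReal (Real.exp (-(1 / 4))) ^ J := by
        gcongr
    _ = _ := by
        rw [← ENNReal.ofReal_pow (Real.exp_pos _).le, ← ENNReal.ofReal_mul (Real.exp_pos _).le,
          ← Real.exp_nat_mul, ← Real.exp_add]
        congr 2
        ring

end Coins

/-- If `X` is independent of `(V, W)`, and `V` of `W`, then `(X, V)` is independent of `W`. -/
theorem indepFun_prodMk_of_indepFun {Ω α β γ : Type*} [MeasurableSpace Ω] [MeasurableSpace α]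
    [MeasurableSpace β] [MeasurableSpace γ] {P : Measure Ω} [IsProbabilityMeasure P]
    {X : Ω → α} {V : Ω → β} {W : Ω → γ} (hX : Measurable X) (hV : Measurable V)
    (hW : Measurable W) (h1 : IndepFun X (fun ω => (V ω, W ω)) P) (h2 : IndepFun V W P) :
    IndepFun (fun ω => (X ω, V ω)) W P := by
  have h3 : IndepFun X V P := h1.comp measurable_id measurable_fst
  rw [indepFun_iff_map_prod_eq_prod_map_map (hX.prodMk hV).aemeasurable hW.aemeasurable,
    h3.map_prod_eq_prod_map_map hX.aemeasurable hV.aemeasurable]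
  have h4 := h1.map_prod_eq_prod_map_map hX.aemeasurable (hV.prodMk hW).aemeasurable
  have hPX := Measure.isProbabilityMeasure_map (μ := P) hX.aemeasurable
  have hPV := Measure.isProbabilityMeasure_map (μ := P) hV.aemeasurable
  have hPW := Measure.isProbabilityMeasure_map (μ := P) hW.aemeasurable
  rw [h2.map_prod_eq_prod_map_map hV.aemeasurable hW.aemeasurable, ← Measure.prodAssoc_prod] at h4
  have h5 := congrArg (Measure.map MeasurableEquiv.prodAssoc.symm) h4
  rw [MeasurableEquiv.map_symm_map, Measure.map_map MeasurableEquiv.prodAssoc.symm.measurable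
    (hX.prodMk (hV.prodMk hW))] at h5
  exact h5

section Environment

variable {D K : ℕ} {Ω : Type*} [mΩ : MeasurableSpace Ω] {P : Measure Ω}
  {f : Fin K → Pt D → ℝ} {X : Fin K → ℕ → Ω → Pt D} {U : ℕ → Ω → ℝ}

/-- The rewards, together with the coins before round `j`. -/
def history (X : Fin K → ℕ → Ω → Pt D) (U : ℕ → Ω → ℝ) (j : ℕ) (ω : Ω) :
    (Fin K × ℕ → Pt D) × (Finset.range j → ℝ) :=
  (fun p => X p.1 p.2 ω, fun i => U i ω)

theorem IsEnvironment.measurable_history (hE : IsEnvironment P f X U) (j : ℕ) :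
    Measurable (history X U j) :=
  (measurable_pi_lambda _ fun p : Fin K × ℕ => hE.measurable_reward p.1 p.2).prodMk
    (measurable_pi_lambda _ fun i => hE.measurable_coin i)

variable [IsProbabilityMeasure P]

theorem IsEnvironment.indepFun_history (hE : IsEnvironment P f X U) (j : ℕ) :
    IndepFun (history X U j) (U j) P := by
  refine indepFun_prodMk_of_indepFun
    (measurable_pi_lambda _ fun p : Fin K × ℕ => hE.measurable_reward p.1 p.2)
    (measurable_pi_lambda _ fun i => hE.measurable_coin i) (hE.measurable_coin j) ?_ ?_
  · exact hE.indep_reward_coin.comp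
      (ψ := fun u : ℕ → ℝ => ((fun i : Finset.range j => u i), u j)) measurable_id
      ((measurable_pi_lambda _ fun i => measurable_pi_apply _).prodMk (measurable_pi_apply _))
  · exact (hE.indep_coin.indepFun_finset (Finset.range j) {j} (by simp) hE.measurable_coin).comp
      (ψ := fun z : ({j} : Finset ℕ) → ℝ => z ⟨j, by simp⟩) measurable_id
      (measurable_pi_apply (⟨j, by simp⟩ : ({j} : Finset ℕ)))

open Classical in
/-- The history determines whether the critical arm `h` is the less often pulled one, so that few
favourable rounds are exponentially unlikely. -/
theorem IsEnvironment.measure_card_favourable_le (hE : IsEnvironment P f X U) {A : TopM D K}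
    (hA : Measurable A.score) (J : ℕ) (b : ℝ) :
    P {ω | (((Finset.range J).filter fun j =>
        A.Favourable (fun i s => X i s ω) (fun j => U j ω) j).card : ℝ) ≤ b} ≤
      ENNReal.ofReal (Real.exp (b - J / 4)) := by
  let ℱ : ℕ → MeasurableSpace Ω := fun j => MeasurableSpace.comap (history X U j) inferInstance
  have hh : ∀ j, Measurable[ℱ j] (history X U j) := fun j => comap_measurable _
  have hXℱ : ∀ j i s, Measurable[ℱ j] (X i s) := fun j i s =>
    ((measurable_pi_apply (i, s)).comp measurable_fst).comp (hh j)
  have hUℱ : ∀ j, ∀ i < j, Measurable[ℱ j] (U i) := fun j i hi =>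
    ((measurable_pi_apply (⟨i, Finset.mem_range.2 hi⟩ : Finset.range j)).comp measurable_snd).comp
      (hh j)
  have h := measure_card_guess_le (ℱ := ℱ) (fun j => (hE.measurable_history j).comap_le)
    hE.measurable_coin hUℱ
    (fun j i hi => @TopM.measurable_hRare_counts _ _ A _ (ℱ j) _ hA (hXℱ j) _ i
      fun i' hi' => hUℱ j i' (hi'.trans_le hi))
    (fun j => (IndepFun_iff_Indep _ _ _).1 (hE.indepFun_history j)) hE.law_coin J b
  convert! h

end Environment

/-! ### The number of rounds -/

/-- The logarithmic factor in the number of pulls that bring the width below the gap `Δ`, which is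
`Δ^{-(4+D)}` times this factor. -/
noncomputable def logFactor (D : ℕ) (y Λ : ℝ) : ℝ :=
  (12 * 42 ^ 2 * (4 + D : ℕ) ^ 4 * (1 + y ^ 2) ^ 2 * Λ ^ 3) ^ (4 + D)

/-- An arm whose gap is within four times the width has been pulled at most `Δ^{-(4+D)}` times, up
to logarithmic factors. -/
theorem le_logFactor_of_gap_le {D t : ℕ} (ht : 3 ≤ t) {Λ Δ S : ℝ} (hΛ : 1 ≤ Λ) (hΔ : 0 < Δ)
    (hS : (Δ ^ (4 + D))⁻¹ ≤ S) (h : Δ ≤ 4 * TopM.width D Λ t) :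
    (t : ℝ) ≤ (Δ ^ (4 + D))⁻¹ * logFactor D (Real.log S) Λ := by
  obtain ⟨hτ, htτ, -⟩ := root_spec D (t := t) (by omega)
  rw [TopM.width] at h
  rw [← pow_add] at htτ
  set τ : ℝ := (t : ℝ) ^ ((1 : ℝ) / (4 + D))
  have hτ0 : 0 < τ := by linarith
  have ht' : (3 : ℝ) ≤ t := by exact_mod_cast ht
  set ℓ : ℝ := Real.log t
  have hℓ : 1 ≤ ℓ := by
    rw [Real.le_log_iff_exp_le (by linarith)]
    linarith [Real.exp_one_lt_d9]
  set y := Real.log S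
  set q : ℕ := 4 + D with hq_def
  have hq : (4 : ℝ) ≤ q := by
    rw [hq_def]
    push_cast
    linarith [Nat.cast_nonneg (α := ℝ) D]
  have h1 : Δ * τ ≤ 12 * Λ * ℓ ^ 2 := by
    rw [← mul_div_assoc, ← mul_div_assoc, le_div_iff₀ hτ0] at h
    have h2 : ℓ ≤ ℓ * Λ := by nlinarith
    have h3 : Λ ≤ ℓ * Λ := by nlinarith
    have h4 : (2 * ℓ + Λ) * ℓ ≤ (3 * (ℓ * Λ)) * ℓ := by gcongr; linarith
    nlinarith
  have h2 : Δ ^ q * t ≤ (12 * Λ * ℓ ^ 2) ^ q := by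
    rw [htτ, ← mul_pow]
    gcongr
  -- Taking logarithms turns this into a bound on `ℓ = log t`.
  have hΔq : 0 < Δ ^ q := by positivity
  have hy : -Real.log (Δ ^ q) ≤ y := by
    rw [← Real.log_inv]
    exact Real.log_le_log (by positivity) hS
  have h3 : Real.log (Δ ^ q) + ℓ ≤ q * (Real.log (12 * Λ) + 2 * Real.log ℓ) := by
    have := Real.log_le_log (by positivity) h2
    rw [Real.log_mul hΔq.ne' (by positivity), Real.log_pow (12 * Λ * ℓ ^ 2) q,
      Real.log_mul (by positivity) (by positivity), Real.log_pow ℓ 2] at this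
    exact_mod_cast this
  have h4 : Real.log (12 * Λ) ≤ 12 * Λ := by
    linarith [Real.log_le_sub_one_of_pos (show 0 < 12 * Λ by positivity)]
  have h5 : Real.log ℓ ≤ ℓ / (4 * q) + 4 * q := by
    have h6 : ℓ = ℓ / (4 * q) * (4 * q) := by field_simp
    have h7 := Real.log_le_sub_one_of_pos (show 0 < ℓ / (4 * q) by positivity)
    have h8 := Real.log_le_sub_one_of_pos (show (0 : ℝ) < 4 * q by positivity)
    conv_lhs => rw [h6]
    rw [Real.log_mul (by positivity) (by positivity)]
    linarith
  have h6 : ℓ ≤ 2 * y + 24 * q * Λ + 16 * q ^ 2 := by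
    have h7 : q * (Real.log (12 * Λ) + 2 * Real.log ℓ) ≤
        q * (12 * Λ + 2 * (ℓ / (4 * q) + 4 * q)) := by gcongr
    have h8 : q * (12 * Λ + 2 * (ℓ / (4 * q) + 4 * q)) = 12 * q * Λ + ℓ / 2 + 8 * q ^ 2 := by
      field_simp
      ring
    linarith
  have h7 : ℓ ≤ 42 * q ^ 2 * (1 + y ^ 2) * Λ := by
    have hA : 1 ≤ 1 + y ^ 2 := by nlinarith
    have h8 : 2 * y ≤ q ^ 2 * (1 + y ^ 2) * Λ := by
      calc 2 * y ≤ 1 * (1 + y ^ 2) * 1 := by nlinarith [sq_nonneg (y - 1)]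
        _ ≤ q ^ 2 * (1 + y ^ 2) * Λ := by
          gcongr
          nlinarith
    have h9 : (q : ℝ) * 1 * Λ ≤ q ^ 2 * (1 + y ^ 2) * Λ := by
      gcongr
      nlinarith
    have h10 : (q : ℝ) ^ 2 * 1 * 1 ≤ q ^ 2 * (1 + y ^ 2) * Λ := by
      gcongr
    linarith
  rw [inv_mul_eq_div, le_div_iff₀ hΔq, mul_comm]
  refine h2.trans ?_
  rw [logFactor, ← hq_def]
  refine pow_le_pow_left₀ (by positivity) ?_ q
  calc 12 * Λ * ℓ ^ 2 ≤ 12 * Λ * (42 * q ^ 2 * (1 + y ^ 2) * Λ) ^ 2 := by gcongr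
    _ = _ := by ring

/-- The polynomial `p_D` of the bound on the sample complexity. -/
noncomputable def samplePoly (D : ℕ) : MvPolynomial (Fin 2) ℝ :=
  MvPolynomial.C (8 : ℝ) * (MvPolynomial.C (2 : ℝ) + MvPolynomial.X 0) *
    (MvPolynomial.C (12 * 42 ^ 2 * ((4 + D : ℕ) : ℝ) ^ 4) * (1 + MvPolynomial.X 1 ^ 2) ^ 2 *
      (MvPolynomial.C (4 : ℝ) + MvPolynomial.C (2 : ℝ) * MvPolynomial.X 0 +
        MvPolynomial.X 1 ^ 2) ^ 3) ^ (4 + D)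

theorem eval_samplePoly (D : ℕ) (x y : ℝ) : MvPolynomial.eval ![x, y] (samplePoly D) =
    8 * (2 + x) * logFactor D y (4 + 2 * x + y ^ 2) := by
  simp [samplePoly, logFactor]

theorem logFactor_nonneg (D : ℕ) {y Λ : ℝ} (hΛ : 0 ≤ Λ) : 0 ≤ logFactor D y Λ := by
  rw [logFactor]
  positivity

theorem logFactor_mono (D : ℕ) {y Λ Λ' : ℝ} (hΛ : 0 ≤ Λ) (h : Λ ≤ Λ') :
    logFactor D y Λ ≤ logFactor D y Λ' := by
  rw [logFactor, logFactor]
  gcongr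

/-- The factor `log K` that the union bound over the arms costs is absorbed: it is at most
polynomial in `log (1/δ)` and `log Σ`, unless `K` is so large in terms of these that the cost of the
initial pulls dominates everything. -/
theorem exists_budget_le (D : ℕ) : ∃ M : ℝ, ∀ (K N₀ : ℕ) (δ S : ℝ), 1 ≤ K → M ≤ N₀ → 0 < δ →
    δ < 1 → 0 < S →
    8 * (2 + Real.log (1 / δ)) * logFactor D (Real.log S) (1 + Real.log (2 * K / δ)) * S ≤
      K * N₀ + MvPolynomial.eval ![Real.log (1 / δ), Real.log S] (samplePoly D) * S := by
  set q : ℕ := 4 + D with hq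
  set c : ℝ := 12 * 42 ^ 2 * (4 + D : ℕ) ^ 4 with hc
  set r : ℕ := 1 + 5 * q with hr
  refine ⟨8 * (8 * c) ^ q * (2 ^ r * r.factorial), fun K N₀ δ S hK hN hδ hδ1 hS => ?_⟩
  have hK' : (1 : ℝ) ≤ K := by exact_mod_cast hK
  have hx : 0 ≤ Real.log (1 / δ) := Real.log_nonneg (by rw [le_div_iff₀ hδ]; linarith)
  have hκ : 0 ≤ Real.log K := Real.log_nonneg hK'
  have hΛ : 1 + Real.log (2 * K / δ) ≤ 2 + Real.log K + Real.log (1 / δ) := by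
    rw [mul_div_assoc, div_eq_mul_one_div, Real.log_mul two_ne_zero (by positivity),
      Real.log_mul (by positivity) (by positivity)]
    linarith [Real.log_two_lt_d9]
  have hΛ0 : 0 ≤ 1 + Real.log (2 * K / δ) := by
    have : 0 ≤ Real.log (2 * K / δ) := Real.log_nonneg (by rw [le_div_iff₀ hδ]; linarith)
    linarith
  rw [eval_samplePoly]
  set x := Real.log (1 / δ)
  set κ := Real.log K with hκ_def
  set Λ := 1 + Real.log (2 * K / δ)
  set y := Real.log S with hy
  rcases le_or_gt κ (x + y ^ 2 + 2) with h | h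
  · have h1 : logFactor D y Λ ≤ logFactor D y (4 + 2 * x + y ^ 2) :=
      logFactor_mono D hΛ0 (by linarith)
    have h2 : 8 * (2 + x) * logFactor D y Λ * S ≤
        8 * (2 + x) * logFactor D y (4 + 2 * x + y ^ 2) * S := by gcongr
    have h3 : (0 : ℝ) ≤ K * N₀ := by positivity
    linarith
  · have hκ0 : 0 < κ := by nlinarith
    have h1 : logFactor D y Λ ≤ (8 * c) ^ q * κ ^ (5 * q) := by
      refine (logFactor_mono D hΛ0 hΛ).trans ?_
      rw [logFactor, pow_mul, ← mul_pow]
      refine pow_le_pow_left₀ (by positivity) ?_ _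
      calc c * (1 + y ^ 2) ^ 2 * (2 + κ + x) ^ 3 ≤ c * κ ^ 2 * (2 * κ) ^ 3 := by
            gcongr
            · nlinarith
            · nlinarith
        _ = _ := by ring
    have h2 : κ ^ r ≤ 2 ^ r * r.factorial * Real.exp (κ / 2) := by
      have := Real.pow_div_factorial_le_exp (κ / 2) (by positivity) r
      rw [div_pow, div_div, div_le_iff₀ (by positivity)] at this
      linarith
    have h3 : S ≤ Real.exp (κ / 2) := by
      rw [← Real.log_le_iff_le_exp hS]
      nlinarith [sq_nonneg (y - 1)]
    have h4 : Real.exp (κ / 2) * Real.exp (κ / 2) = K := by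
      rw [← Real.exp_add, add_halves, hκ_def, Real.exp_log (by linarith)]
    have h5 : 0 ≤ 8 * (2 + x) * logFactor D y (4 + 2 * x + y ^ 2) * S := by
      have := logFactor_nonneg D (y := y) (show 0 ≤ 4 + 2 * x + y ^ 2 by positivity)
      positivity
    have h6 : 2 + x ≤ κ := by nlinarith
    calc 8 * (2 + x) * logFactor D y Λ * S
        ≤ 8 * κ * ((8 * c) ^ q * κ ^ (5 * q)) * Real.exp (κ / 2) := by
          have := logFactor_nonneg D (y := y) hΛ0
          gcongr
      _ = 8 * (8 * c) ^ q * κ ^ r * Real.exp (κ / 2) := by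
          rw [hr, pow_add]
          ring
      _ ≤ 8 * (8 * c) ^ q * (2 ^ r * r.factorial * Real.exp (κ / 2)) * Real.exp (κ / 2) := by
          gcongr
      _ = 8 * (8 * c) ^ q * (2 ^ r * r.factorial) * K := by
          rw [← h4]
          ring
      _ ≤ N₀ * K := by gcongr
      _ ≤ _ := by linarith

namespace TopM

variable {D K : ℕ} {A : TopM D K}

theorem level_pos (hm : 0 < A.m) (hmK : A.m < K) (hδ : 0 < A.δ) (i : Fin K) : 0 < A.level i :=
  lt_of_lt_of_le (by have : (0 : ℝ) < K := by exact_mod_cast (by omega : 0 < K)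
                     positivity) (le_level hm hmK hδ i)

theorem level_le_one (hm : 0 < A.m) (hmK : A.m < K) (hδ : 0 < A.δ) (hδ1 : A.δ < 1) (i : Fin K) :
    A.level i ≤ 1 := by
  have h1 : (1 : ℝ) ≤ A.m := by exact_mod_cast hm
  have h2 : (A.m : ℝ) + 1 ≤ K := by exact_mod_cast hmK
  rw [level]
  split_ifs
  · rw [div_le_one (by linarith)]
    linarith
  · rw [div_le_one (by linarith)]
    linarith

theorem sum_level (hm : 0 < A.m) (hmK : A.m < K) : ∑ i, A.level i = A.δ := by
  have h1 : (0 : ℝ) < A.m := by exact_mod_cast hm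
  have h2 : (A.m : ℝ) < K := by exact_mod_cast hmK
  have h3 : (K : ℝ) - A.m ≠ 0 := by linarith
  have h4 : (Finset.univ.filter fun i : Fin K => ¬ (i : ℕ) < A.m).card = K - A.m := by
    rw [Finset.filter_not, Finset.card_sdiff_of_subset (Finset.filter_subset _ _)]
    have := card_topSet hmK.le
    rw [topSet] at this
    rw [this]
    simp
  have h5 : (Finset.univ.filter fun i : Fin K => (i : ℕ) < A.m).card = A.m :=
    card_topSet hmK.le
  simp only [level, Finset.sum_ite, Finset.sum_const, h4, h5, nsmul_eq_mul]
  rw [Nat.cast_sub hmK.le]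
  field_simp
  ring

/-- Union bound over the arms and the sample sizes. The levels of the arms add up to `δ`, and half
of `δ` suffices here; the other half is left for the coins. -/
theorem measure_not_good_le {Ω : Type*} [MeasurableSpace Ω] {P : Measure Ω}
    {X : Fin K → ℕ → Ω → Pt D} {θ : Fin K → ℝ} (hm : 0 < A.m) (hmK : A.m < K) (hδ : 0 < A.δ)
    (hN : ∑' k : ℕ, 1 / ((k + A.N₀ : ℕ) : ℝ) ^ 2 ≤ 1 / 2)
    (h : ∀ i, ∀ t ≥ A.N₀, P {ω | confRadius D A.N₀ t (A.level i) <
      |A.score (empMode A.tieSample t fun s => X i s ω) - θ i|} ≤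
        ENNReal.ofReal (A.level i / (t : ℝ) ^ 2)) :
    P {ω | ¬ A.Good θ fun i s => X i s ω} ≤ ENNReal.ofReal (A.δ / 2) := by
  have hs : Summable fun k : ℕ => 1 / ((k + A.N₀ : ℕ) : ℝ) ^ 2 :=
    (Real.summable_one_div_nat_pow.2 one_lt_two).comp_injective (add_left_injective A.N₀)
  have hsub : {ω | ¬ A.Good θ fun i s => X i s ω} ⊆
      ⋃ i, ⋃ k : ℕ, {ω | confRadius D A.N₀ (k + A.N₀) (A.level i) <
        |A.score (empMode A.tieSample (k + A.N₀) fun s => X i s ω) - θ i|} := by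
    intro ω hω
    simp only [Good, Set.mem_ofPred_eq, not_forall, not_le] at hω
    obtain ⟨i, t, ht, hlt⟩ := hω
    refine Set.mem_iUnion.2 ⟨i, Set.mem_iUnion.2 ⟨t - A.N₀, ?_⟩⟩
    rwa [Nat.sub_add_cancel ht]
  have hi : ∀ i, P (⋃ k : ℕ, {ω | confRadius D A.N₀ (k + A.N₀) (A.level i) <
      |A.score (empMode A.tieSample (k + A.N₀) fun s => X i s ω) - θ i|}) ≤
        ENNReal.ofReal (A.level i / 2) := by
    intro i
    have hl := (level_pos hm hmK hδ i).le
    refine (measure_iUnion_le _).trans ((ENNReal.tsum_le_tsum fun k =>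
      h i (k + A.N₀) (Nat.le_add_left _ _)).trans ?_)
    simp_rw [div_eq_mul_one_div (A.level i) (_ ^ 2)]
    rw [← ENNReal.ofReal_tsum_of_nonneg (fun k => by positivity) (hs.mul_left _), tsum_mul_left]
    refine ENNReal.ofReal_le_ofReal ?_
    rw [div_eq_mul_one_div]
    gcongr
  calc _ ≤ ∑ i, ENNReal.ofReal (A.level i / 2) :=
        (measure_mono hsub).trans ((measure_iUnion_fintype_le _ _).trans
          (Finset.sum_le_sum fun i _ => hi i))
    _ = _ := by
      rw [← ENNReal.ofReal_sum_of_nonneg fun i _ => by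
        have := level_pos hm hmK hδ i
        positivity, ← Finset.sum_div, sum_level hm hmK]

open Classical in
/-- On the good event, a run of `J` rounds without stopping has few favourable rounds; and if the
budget is less than one pull, then the algorithm stops at once. -/
theorem Good.card_favourable_le {θ : Fin K → ℝ} {x : Fin K → ℕ → Pt D} (hm : 0 < A.m)
    (hmK : A.m < K) (hδ : 0 < A.δ) (hδ1 : A.δ < 1) (hN : Real.exp (2 * (4 + D)) ≤ A.N₀)
    (hg : A.Good θ x) (hθ : Antitone θ)
    (hgap : θ ⟨A.m, hmK⟩ < θ ⟨A.m - 1, (Nat.sub_le _ _).trans_lt hmK⟩)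
    {B : ℝ} (hB : B = logFactor D (Real.log (hardness D θ A.m hm hmK))
      (1 + Real.log (2 * K / A.δ)) * hardness D θ A.m hm hmK) (u : ℕ → ℝ) (J : ℕ)
    (hrun : ∀ j ≤ J, ¬ A.Stops x (A.counts x u j)) :
    1 ≤ B ∧ (((Finset.range J).filter fun j => A.Favourable x u j).card : ℝ) ≤ B := by
  set S := hardness D θ A.m hm hmK with hS
  set Λ := 1 + Real.log (2 * K / A.δ) with hΛ_def
  have hK1 : (1 : ℝ) ≤ K := by exact_mod_cast (by omega : 1 ≤ K)
  have hΛ : 1 ≤ Λ := by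
    have : 0 ≤ Real.log (2 * K / A.δ) := Real.log_nonneg (by rw [le_div_iff₀ hδ]; linarith)
    linarith
  have hQ := logFactor_nonneg D (y := Real.log S) (zero_le_one.trans hΛ)
  have hgi : ∀ i, 0 < (gap θ A.m hm hmK i ^ (4 + D))⁻¹ := fun i => by
    have := gap_pos hm hmK hθ hgap i
    positivity
  have hgS : ∀ i, (gap θ A.m hm hmK i ^ (4 + D))⁻¹ ≤ S := fun i =>
    Finset.single_le_sum (f := fun i => (gap θ A.m hm hmK i ^ (4 + D))⁻¹)
      (fun i _ => (hgi i).le) (Finset.mem_univ i)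
  have hN3 : 3 ≤ A.N₀ := by
    have h1 := Real.add_one_le_exp (2 * (4 + D) : ℝ)
    have : (3 : ℝ) ≤ A.N₀ := by linarith [Nat.cast_nonneg (α := ℝ) D]
    exact_mod_cast this
  set b : Fin K → ℝ := fun i => (gap θ A.m hm hmK i ^ (4 + D))⁻¹ * logFactor D (Real.log S) Λ
    with hb
  have hb0 : ∀ i, 0 ≤ b i := fun i => mul_nonneg (hgi i).le hQ
  have hsum : ∑ i, b i = B := by
    rw [hb, ← Finset.sum_mul, hB, mul_comm]
    rfl
  have hneed : ∀ T : Fin K → ℕ, (∀ i, A.N₀ ≤ T i) → ¬ A.Stops x T →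
      (T (A.rareArm x T) : ℝ) ≤ b (A.rareArm x T) := fun T hT hns =>
    le_logFactor_of_gap_le (hN3.trans (hT _)) hΛ (gap_pos hm hmK hθ hgap _) (hgS _)
      (hg.gap_rareArm_le hm hmK hδ hδ1 hN hT hθ hgap hns)
  constructor
  · have h1 := hneed _ (A.le_counts x u 0) (hrun 0 (Nat.zero_le J))
    have h2 := Finset.single_le_sum (f := b) (fun i _ => hb0 i)
      (Finset.mem_univ (A.rareArm x (A.counts x u 0)))
    have h3 : (1 : ℝ) ≤ A.counts x u 0 (A.rareArm x (A.counts x u 0)) := by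
      exact_mod_cast (by omega : 1 ≤ A.N₀).trans (A.le_counts x u 0 _)
    linarith
  · refine (TopM.card_favourable_le (by omega) hb0 hneed J fun j hj => hrun j hj.le).trans ?_
    rw [← hsum]
    exact Finset.sum_le_sum fun i _ => min_le_right _ _

end TopM

open Classical in
/-- The sample size from which on the concentration of the mode estimate is available for the
density `f`. -/
noncomputable def startSize.{u} (D : ℕ) (hD : 0 < D) (L : NNReal) (f : Pt D → ℝ) : ℕ :=
  if h : ∃ x₀, IsTopMode f x₀ then
    (exists_forall_measure_confRadius_lt_le.{u} h.choose_spec hD L).choose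
  else 0

theorem IsTopMode.unique {D : ℕ} {f : Pt D → ℝ} {x₀ x₁ : Pt D} (h₀ : IsTopMode f x₀)
    (h₁ : IsTopMode f x₁) : x₀ = x₁ := by
  by_contra hne
  exact lt_asymm (h₀.top x₁ (Ne.symm hne)) (h₁.top x₀ hne)

end ModalBandit

theorem mainTheorem6 :
    ∃ C₀ : ℝ, 0 < C₀ ∧
    ∀ D : ℕ, 0 < D →
    ∃ polyLog : MvPolynomial (Fin 2) ℝ,
    ∀ L : NNReal,
    ∃ N : (Pt D → ℝ) → ℕ,
    ∀ (K : ℕ) (A : TopM D K) (hm : 0 < A.m) (hmK : A.m < K)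
      (f : Fin K → Pt D → ℝ) (x₀ : Fin K → Pt D) (θ : Fin K → ℝ)
      (Ω : Type*) [MeasurableSpace Ω] (P : Measure Ω) [IsProbabilityMeasure P]
      (X : Fin K → ℕ → Ω → Pt D) (U : ℕ → Ω → ℝ) (n : ℕ),
      0 < A.δ → A.δ < 1 →
      LipschitzWith L A.score →
      (∀ i, IsTopMode (f i) (x₀ i)) →
      (∀ i, θ i = A.score (x₀ i)) →
      Antitone θ →
      θ ⟨A.m, hmK⟩ < θ ⟨A.m - 1, by omega⟩ →
      (∀ i, N (f i) ≤ A.N₀) →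
      IsEnvironment P f X U →
      C₀ * (K * A.N₀) +
          MvPolynomial.eval ![Real.log (1 / A.δ), Real.log (hardness D θ A.m hm hmK)] polyLog *
            hardness D θ A.m hm hmK ≤ (n : ℝ) →
      ENNReal.ofReal (1 - A.δ) ≤
        P {ω | A.StopsWithin (fun i s => X i s ω) (fun j => U j ω) n
          (Finset.univ.filter (fun i : Fin K => (i : ℕ) < A.m))} := by
  refine ⟨2, two_pos, fun D hD => ⟨samplePoly D, fun L => ?_⟩⟩
  -- `N₁` is large enough for the tail of `∑ 1 / t²` to be at most `1 / 2`.
  obtain ⟨M, hM⟩ := exists_budget_le D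
  obtain ⟨N₁, hN₁⟩ := eventually_atTop.1 ((tendsto_sum_nat_add fun k : ℕ =>
    1 / (k : ℝ) ^ 2).eventually_le_const one_half_pos)
  refine ⟨fun f => max (startSize D hD L f) (max N₁ (max ⌈M⌉₊ ⌈Real.exp (2 * (4 + D))⌉₊)), ?_⟩
  intro K A hm hmK f x₀ θ Ω _ P _ X U n hδ hδ1 hL hf hθx hθ hgap hN hE hn
  have i₀ : Fin K := ⟨0, by omega⟩
  have hN₀ := (le_max_right _ _).trans (hN i₀)
  have hNM : M ≤ A.N₀ := (Nat.le_ceil M).trans (by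
    exact_mod_cast (le_max_left _ _).trans ((le_max_right _ _).trans hN₀))
  have hNexp : Real.exp (2 * (4 + D)) ≤ A.N₀ := (Nat.le_ceil _).trans (by
    exact_mod_cast (le_max_right _ _).trans ((le_max_right _ _).trans hN₀))
  have hbad : P {ω | ¬ A.Good θ fun i s => X i s ω} ≤ ENNReal.ofReal (A.δ / 2) := by
    refine TopM.measure_not_good_le hm hmK hδ (hN₁ _ ((le_max_left _ _).trans hN₀))
      fun i t ht => ?_
    have hex : ∃ x, IsTopMode (f i) x := ⟨x₀ i, hf i⟩
    have hspec := (exists_forall_measure_confRadius_lt_le hex.choose_spec hD L).choose_spec A.N₀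
      (by
        have := (le_max_left _ _).trans (hN i)
        rwa [startSize, dif_pos hex] at this)
      t ht (A.level i) (TopM.level_pos hm hmK hδ i) (TopM.level_le_one hm hmK hδ hδ1 i) Ω P (X i)
      A.tieSample A.score hL (hE.measurable_reward i)
      (hE.indep_reward.precomp (g := fun s : ℕ => (i, s)) (Prod.mk_right_injective i))
      (hE.law_reward i)
    rwa [hex.choose_spec.unique (hf i), ← hθx i] at hspec
  set S := hardness D θ A.m hm hmK with hS
  have hS0 : 0 < S := Finset.sum_pos (fun i _ => by
    have := gap_pos hm hmK hθ hgap i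
    positivity) ⟨i₀, Finset.mem_univ _⟩
  set B := logFactor D (Real.log S) (1 + Real.log (2 * K / A.δ)) * S with hB
  have hbudget := hM K A.N₀ A.δ S (by omega) hNM hδ hδ1 hS0
  have hx : 0 ≤ Real.log (1 / A.δ) := Real.log_nonneg (by rw [le_div_iff₀ hδ]; linarith)
  have hJ : K * A.N₀ + 8 * (2 + Real.log (1 / A.δ)) * B ≤ (n : ℝ) := by
    rw [hB]
    linarith
  have hB0 : 0 ≤ B := by
    have hK1 : (1 : ℝ) ≤ K := by exact_mod_cast (by omega : 1 ≤ K)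
    have : 0 ≤ Real.log (2 * K / A.δ) := Real.log_nonneg (by rw [le_div_iff₀ hδ]; linarith)
    exact mul_nonneg (logFactor_nonneg D (by linarith)) hS0.le
  have hKn : K * A.N₀ ≤ n := by
    have h1 : 0 ≤ 8 * (2 + Real.log (1 / A.δ)) * B := by positivity
    have h2 : ((K * A.N₀ : ℕ) : ℝ) ≤ n := by
      push_cast
      linarith
    exact_mod_cast h2
  set J := n - K * A.N₀ with hJ_def
  have hJ' : 8 * (2 + Real.log (1 / A.δ)) * B ≤ (J : ℝ) := by
    rw [hJ_def, Nat.cast_sub hKn]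
    push_cast
    linarith
  classical
  set E := {ω | A.StopsWithin (fun i s => X i s ω) (fun j => U j ω) n
    (Finset.univ.filter (fun i : Fin K => (i : ℕ) < A.m))} with hE_def
  have hfail : ∀ ω ∉ E, (A.Good θ fun i s => X i s ω) → 1 ≤ B ∧
      (((Finset.range J).filter fun j =>
        A.Favourable (fun i s => X i s ω) (fun j => U j ω) j).card : ℝ) ≤ B := by
    intro ω hω hg
    refine hg.card_favourable_le hm hmK hδ hδ1 hNexp hθ hgap hB _ J fun j hj hst => hω ?_
    exact ⟨j, by omega, hst, hg.high_eq hm hmK (A.le_counts _ _ j) hθ hgap hst⟩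
  have hcoin : P (Eᶜ ∩ {ω | A.Good θ fun i s => X i s ω}) ≤ ENNReal.ofReal (A.δ / 2) := by
    rcases lt_or_ge B 1 with hB1 | hB1
    · have : Eᶜ ∩ {ω | A.Good θ fun i s => X i s ω} = ∅ :=
        Set.eq_empty_of_forall_notMem fun ω hω => not_le.2 hB1 (hfail ω hω.1 hω.2).1
      rw [this, measure_empty]
      exact zero_le
    · refine (measure_mono fun ω hω => (hfail ω hω.1 hω.2).2).trans
        ((hE.measure_card_favourable_le hL.continuous.measurable J B).trans
          (ENNReal.ofReal_le_ofReal ?_))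
      have h1 : B - J / 4 ≤ Real.log (A.δ / 2) := by
        have h2 : Real.log (A.δ / 2) = -Real.log (1 / A.δ) - Real.log 2 := by
          rw [Real.log_div hδ.ne' two_ne_zero, one_div, Real.log_inv]
          ring
        rw [h2]
        nlinarith [Real.log_two_lt_d9]
      exact (Real.exp_le_exp.2 h1).trans (le_of_eq (Real.exp_log (by positivity)))
  have hcompl : P Eᶜ ≤ ENNReal.ofReal A.δ := by
    calc P Eᶜ ≤ P ((Eᶜ ∩ {ω | A.Good θ fun i s => X i s ω}) ∪
          {ω | ¬ A.Good θ fun i s => X i s ω}) := measure_mono fun ω hω => by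
            by_cases hg : A.Good θ fun i s => X i s ω
            · exact Or.inl ⟨hω, hg⟩
            · exact Or.inr hg
      _ ≤ ENNReal.ofReal (A.δ / 2) + ENNReal.ofReal (A.δ / 2) :=
          (measure_union_le _ _).trans (add_le_add hcoin hbad)
      _ = ENNReal.ofReal A.δ := by
          rw [← ENNReal.ofReal_add (by positivity) (by positivity), add_halves]
  rw [ENNReal.ofReal_sub _ hδ.le, ENNReal.ofReal_one, tsub_le_iff_right]
  calc (1 : ENNReal) = P (E ∪ Eᶜ) := by rw [Set.union_compl_self, measure_univ]
    _ ≤ P E + P Eᶜ := measure_union_le _ _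
    _ ≤ _ := by gcongr
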